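/- For $p\in[0,1]$ let $\mu_p$ be the Bernoulli measure on $2^\omega$ given by $\mu_p(\llbracket\sigma\rrbracket)=p^{\#_0(\sigma)}(1-p)^{\#_1(\sigma)}$, where $\llbracket\sigma\rrbracket$ is the set of infinite binary sequences extending the finite string $\sigma$ and $\#_i(\sigma)$ is the number of occurrences of $i$ in $\sigma$. A sequence $x\in 2^\omega$ is Bernoulli $p$-random if $x\notin\bigcap_i\mathcal U_i$ for every sequence $(\mathcal U_i)_{i\in\omega}$ that is uniformly $\Sigma^0_1$ relative to (the binary expansion of) $p$ and satisfies $\mu_p(\mathcal U_i)\le 2^{-i}$ for all $i$. A sequence $y\in 2^\omega$ is Martin-Löf random if $y\notin\bigcap_i\mathcal U_i$ for every uniformly $\Sigma^0_1$ sequence $(\mathcal U_i)_{i\in\omega}$ with $\lambda(\mathcal U_i)\le 2^{-i}$ for all $i$, where $\lambda$ is the Lebesgue measure, $\lambda(\llbracket\sigma\rrbracket)=2^{-|\sigma|}$. **Theorem.** For every $p\in(0,1)$ there are a Bernoulli $p$-random sequence $x\in2^\omega$ and a Martin-Löf random sequence $y\in2^\omega$ that are Turing equivalent, $x\equiv_T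 y$. -/

import Mathlib

open MeasureTheory
open scoped ENNReal

noncomputable section

namespace BernoulliRandomness

/-- Cantor space `2^ω`; the bit `0` is `false` and the bit `1` is `true`. -/
abbrev Cantor : Type := ℕ → Bool

/-- The basic clopen set `⟦σ⟧` of all sequences that extend the finite string `σ`. -/
def cylinder (σ : List Bool) : Set Cantor :=
  {x | ∀ (i : ℕ) (h : i < σ.length), x i = σ[i]}

/-- The Bernoulli measure `μ_p` on Cantor space: the bits are independent, and each of them is
`0` with probability `p` and `1` with probability `1 - p`. -/
def bernoulli (p : unitInterval) : Measure Cantor :=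
  Measure.infinitePi fun _ : ℕ => ProbabilityTheory.bernoulliMeasure false true p

/-- The Lebesgue (fair coin) measure on Cantor space. -/
def lebesgue : Measure Cantor :=
  bernoulli ⟨1 / 2, by norm_num, by norm_num⟩

/-- A binary sequence as an oracle. -/
def oracle (x : Cantor) : ℕ →. ℕ := fun n => Part.some (x n).toNat

/-- Turing equivalence of binary sequences. -/
def TuringEquiv (x y : Cantor) : Prop := TuringEquivalent (oracle x) (oracle y)

/-- The binary expansion of a real in `[0, 1]`, through which a real is used as an oracle: the
`n`-th bit is the parity of `⌊p * 2 ^ (n + 1)⌋` (so a dyadic rational below `1` gets its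
expansion that ends in zeros). -/
def binaryExpansion (p : unitInterval) : Cantor :=
  fun n => decide (Real.digits (p : ℝ) 2 n = 1)

/-- `U` is a uniformly effectively open sequence of subsets of Cantor space, relative to the
oracles in `O`: some total `O`-computable function enumerates, for each `i`, strings
(the value `none` standing for no string at this stage) whose cylinders have union `U i`. -/
def UniformlySigma1In (O : Set (ℕ →. ℕ)) (U : ℕ → Set Cantor) : Prop :=
  ∃ f : ℕ → ℕ → Option (List Bool), ComputableIn₂ O f ∧
    ∀ i, U i = {x | ∃ s σ, f i s = some σ ∧ x ∈ cylinder σ}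

/-- A `μ`-Martin-Löf test relative to the oracles in `O`. -/
def IsMLTest (μ : Measure Cantor) (O : Set (ℕ →. ℕ)) (U : ℕ → Set Cantor) : Prop :=
  UniformlySigma1In O U ∧ ∀ i, μ (U i) ≤ (2⁻¹ : ℝ≥0∞) ^ i

/-- `x` passes every `μ`-Martin-Löf test relative to the oracles in `O`. -/
def PassesMLTests (μ : Measure Cantor) (O : Set (ℕ →. ℕ)) (x : Cantor) : Prop :=
  ∀ U : ℕ → Set Cantor, IsMLTest μ O U → x ∉ ⋂ i, U i

/-- Martin-Löf random sequences: random for Lebesgue measure, without an oracle. -/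
def MLRandom (x : Cantor) : Prop := PassesMLTests lebesgue ∅ x

/-- Bernoulli `p`-random sequences: those that pass every `μ_p`-Martin-Löf test relative to
the oracle `p`. -/
def BernoulliRandom (p : unitInterval) (x : Cantor) : Prop :=
  PassesMLTests (bernoulli p) {oracle (binaryExpansion p)} x

/-- The values `μ_p(⟦σ⟧) = p ^ #₀(σ) * (1 - p) ^ #₁(σ)`. -/
theorem bernoulli_cylinder (p : unitInterval) (σ : List Bool) :
    bernoulli p (cylinder σ) =
      ENNReal.ofReal ((p : ℝ) ^ σ.count false * (1 - (p : ℝ)) ^ σ.count true) := by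
  have hcyl : cylinder σ =
      Set.pi (Finset.range σ.length) fun i => {b : Bool | b = σ.getD i false} := by
    ext x
    simp only [cylinder, Set.mem_ofPred_eq, Set.mem_pi, Finset.coe_range, Set.mem_Iio]
    refine forall_congr' fun i => forall_congr' fun h => ?_
    simp [h]
  have hb : ∀ b : Bool, ProbabilityTheory.bernoulliMeasure false true p {c : Bool | c = b} =
      ENNReal.ofReal (if b = false then (p : ℝ) else 1 - (p : ℝ)) := by
    intro b
    have h0 : ((unitInterval.toNNReal p : NNReal) : ℝ≥0∞) = ENNReal.ofReal (p : ℝ) := by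
      rw [ENNReal.ofReal, Real.toNNReal_of_nonneg p.2.1]
      rfl
    have h1 : ((unitInterval.toNNReal (unitInterval.symm p) : NNReal) : ℝ≥0∞) =
        ENNReal.ofReal (1 - (p : ℝ)) := by
      rw [ENNReal.ofReal, Real.toNNReal_of_nonneg (sub_nonneg.2 p.2.2)]
      rfl
    classical
    rw [ProbabilityTheory.bernoulliMeasure_apply p MeasurableSet.of_discrete]
    cases b <;> simp [h0, h1]
  rw [hcyl, bernoulli, Measure.infinitePi_pi _ (fun i _ => MeasurableSet.of_discrete)]
  simp only [hb]
  rw [← ENNReal.ofReal_prod_of_nonneg (fun i _ => by split_ifs <;> [exact p.2.1; linarith [p.2.2]])]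
  congr 1
  clear hcyl
  induction σ with
  | nil => simp
  | cons b σ ih =>
    rw [List.length_cons, Finset.prod_range_succ']
    simp only [List.getD_cons_succ, List.getD_cons_zero, ih]
    cases b <;> simp [pow_succ] <;> ring

theorem lebesgue_cylinder (σ : List Bool) : lebesgue (cylinder σ) = (2⁻¹ : ℝ≥0∞) ^ σ.length := by
  rw [lebesgue, bernoulli_cylinder]
  have h : σ.length = σ.count false + σ.count true := by
    induction σ with
    | nil => rfl
    | cons b σ ih => cases b <;> simp <;> omega
  have h2 : (1 : ℝ) - 1 / 2 = 2⁻¹ := by norm_num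
  have h3 : (1 : ℝ) / 2 = 2⁻¹ := by norm_num
  simp only [h2]
  rw [h3, ← pow_add, ← h, ENNReal.ofReal_pow (by norm_num), ENNReal.ofReal_inv_of_pos (by norm_num)]
  simp

end BernoulliRandomness

end

/-!
The idea is that of the Kučera–Gács theorem, used in both directions at once. The sequence `x` is
the limit of strings `σ 0, σ 1, …` of rapidly increasing lengths, chosen so that a prescribed amount
of `μ_p`-measure in the cylinder of `σ n` avoids every test considered so far. No single string of
the next length has much measure, so at least two extensions of `σ n` keep enough measure, and
choosing the first or the last of them codes one bit. That an extension keeps too little measure is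
semidecidable relative to `p`, hence `x` and `p` together compute the coded bits: the bit is `0`
exactly when all the earlier competitors are seen to die, and `1` when all the later ones are.

The bits at even positions tell which of all effectively open sequences are tests. This is not
decidable relative to `p`, but the decoder needs it to know what the construction avoided. The bits
at odd positions are those of the sequence `y`, which is built in the same way at the same time and
codes the bits of `x`. Finally, the decoder need not be given `p`, since `x` computes it: by
Chebyshev's inequality the frequencies of `0` in long initial segments of a `μ_p`-random sequence
approximate `p` at a computable rate.
-/

namespace BernoulliRandomness

open Encodable Filter Topology

/-! ### Initial segments -/

section InitSeg

variable {α : Type*}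

/-- The initial segment of length `k` of an infinite sequence. -/
def initSeg (x : ℕ → α) (k : ℕ) : List α := (List.range k).map x

@[simp]
theorem length_initSeg (x : ℕ → α) (k : ℕ) : (initSeg x k).length = k := by
  simp [initSeg]

theorem take_initSeg (x : ℕ → α) {j k : ℕ} (h : j ≤ k) : (initSeg x k).take j = initSeg x j := by
  simp [initSeg, ← List.map_take, List.take_range, h]

theorem initSeg_prefix (x : ℕ → α) {j k : ℕ} (h : j ≤ k) : initSeg x j <+: initSeg x k :=
  take_initSeg x h ▸ List.take_prefix j _

theorem initSeg_succ (x : ℕ → α) (k : ℕ) : initSeg x (k + 1) = initSeg x k ++ [x k] := by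
  simp [initSeg, List.range_succ]

theorem getElem?_initSeg (x : ℕ → α) {i k : ℕ} (h : i < k) : (initSeg x k)[i]? = some (x i) := by
  simp [initSeg, h]

theorem getElem?_initSeg_eq_some {x : ℕ → α} {i k : ℕ} {a : α} :
    (initSeg x k)[i]? = some a ↔ i < k ∧ x i = a := by
  simp only [initSeg, List.getElem?_map, Option.map_eq_some_iff, List.getElem?_eq_some_iff,
    List.length_range, List.getElem_range]
  grind

end InitSeg

theorem mem_cylinder_iff {x : Cantor} {σ : List Bool} :
    x ∈ cylinder σ ↔ initSeg x σ.length = σ := by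
  simp [cylinder, List.ext_getElem_iff, initSeg]

theorem mem_cylinder_concat {x : Cantor} {σ : List Bool} {b : Bool} :
    x ∈ cylinder (σ ++ [b]) ↔ x ∈ cylinder σ ∧ x σ.length = b := by
  rw [mem_cylinder_iff, mem_cylinder_iff, List.length_append, List.length_singleton, initSeg_succ]
  exact ⟨fun h => by simpa using List.append_inj' h rfl, fun ⟨h, hb⟩ => by rw [h, hb]⟩

/-! ### The use principle -/

section IncreasingLimit

variable {ι α β : Type*} [SemilatticeSup ι]

/-- The partial value `A` is the limit of the increasing family `a` of partial values: `A` is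
undefined if all `a i` are, and otherwise `a i = A` for all large `i`. -/
structure IsIncreasingLimit (a : ι → Part α) (A : Part α) : Prop where
  mono : Monotone a
  mem_iff : ∀ m, m ∈ A ↔ ∃ i, m ∈ a i

theorem IsIncreasingLimit.const [Nonempty ι] (A : Part α) : IsIncreasingLimit (fun _ : ι => A) A :=
  ⟨monotone_const, by simp⟩

theorem IsIncreasingLimit.bind {a : ι → Part α} {A : Part α} {b : ι → α → Part β}
    {B : α → Part β} (ha : IsIncreasingLimit a A)
    (hb : ∀ m, IsIncreasingLimit (fun i => b i m) (B m)) :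
    IsIncreasingLimit (fun i => (a i).bind (b i)) (A.bind B) where
  mono := ha.mono.partBind fun _ _ hij m => (hb m).mono hij
  mem_iff n := by
    simp only [Part.mem_bind_iff, ha.mem_iff, (hb _).mem_iff]
    constructor
    · rintro ⟨m, ⟨i, hi⟩, j, hj⟩
      exact ⟨i ⊔ j, m, ha.mono le_sup_left _ hi, (hb m).mono le_sup_right _ hj⟩
    · rintro ⟨i, m, hi, hj⟩
      exact ⟨m, ⟨i, hi⟩, i, hj⟩

theorem IsIncreasingLimit.map [Nonempty ι] {a : ι → Part α} {A : Part α} (f : α → β)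
    (ha : IsIncreasingLimit a A) : IsIncreasingLimit (fun i => (a i).map f) (A.map f) := by
  simpa only [Part.bind_some_eq_map] using ha.bind fun m => .const (Part.some (f m))

theorem IsIncreasingLimit.natRec {a : ι → Part α} {A : Part α} {b : ι → ℕ → α → Part α}
    {B : ℕ → α → Part α} (ha : IsIncreasingLimit a A)
    (hb : ∀ n m, IsIncreasingLimit (fun i => b i n m) (B n m)) (n : ℕ) :
    IsIncreasingLimit
      (fun i => Nat.rec (motive := fun _ => Part α) (a i) (fun n IH => IH.bind (b i n)) n)
      (Nat.rec (motive := fun _ => Part α) A (fun n IH => IH.bind (B n)) n) := by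
  induction n with
  | zero => exact ha
  | succ n ih => exact ih.bind (hb n)

theorem IsIncreasingLimit.rfind [Nonempty ι] {a : ι → ℕ →. Bool} {A : ℕ →. Bool}
    (ha : ∀ n, IsIncreasingLimit (fun i => a i n) (A n)) :
    IsIncreasingLimit (fun i => Nat.rfind (a i)) (Nat.rfind A) where
  mono i j hij m hm := by
    obtain ⟨hfound, hbelow⟩ := Nat.mem_rfind.1 hm
    exact Nat.mem_rfind.2 ⟨(ha m).mono hij _ hfound, fun {n} hn => (ha n).mono hij _ (hbelow hn)⟩
  mem_iff m := by
    simp only [Nat.mem_rfind, (ha _).mem_iff]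
    constructor
    · rintro ⟨⟨i, hi⟩, hbelow⟩
      choose! k hk using fun n (hn : n < m) => hbelow hn
      obtain ⟨j, hj⟩ := ((Set.finite_Iio m).image k).bddAbove
      refine ⟨i ⊔ j, (ha m).mono le_sup_left _ hi, fun {n} hn => ?_⟩
      have hkn : k n ≤ j := hj (Set.mem_image_of_mem k hn)
      exact (ha n).mono (hkn.trans le_sup_right) _ (hk n hn)
    · rintro ⟨i, hi, hbelow⟩
      exact ⟨⟨i, hi⟩, fun {n} hn => ⟨i, hbelow hn⟩⟩

end IncreasingLimit

/-- The partial recursive functional `φ`, applied to longer and longer initial segments of the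
oracle `x`, computes the partial function `f`. -/
structure IsUseFunctional (x : Cantor) (φ : List Bool → ℕ →. ℕ) (f : ℕ →. ℕ) : Prop where
  partrec : Partrec₂ φ
  limit : ∀ n, IsIncreasingLimit (fun k => φ (initSeg x k) n) (f n)

namespace IsUseFunctional

variable {x : Cantor} {φ ψ : List Bool → ℕ →. ℕ} {f g : ℕ →. ℕ}

theorem of_partrec (hf : Partrec f) : IsUseFunctional x (fun _ => f) f where
  partrec := hf.comp Computable.snd
  limit n := .const (f n)

theorem oracle : IsUseFunctional x (fun σ n => ((σ[n]?).map Bool.toNat : Option ℕ))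
    (BernoulliRandomness.oracle x) where
  partrec := Computable.ofOption
    (Primrec.option_map Primrec.list_getElem? ((Primrec.dom_bool _).comp Primrec.snd).to₂).to_comp
  limit n := by
    constructor
    · intro j k hjk m
      simp only [Part.mem_ofOption, Option.mem_def, Option.map_eq_some_iff,
        getElem?_initSeg_eq_some]
      rintro ⟨b, ⟨hn, hb⟩, hm⟩
      exact ⟨b, ⟨hn.trans_le hjk, hb⟩, hm⟩
    · intro m
      simp only [BernoulliRandomness.oracle, Part.mem_some_iff, Part.mem_ofOption, Option.mem_def,
        Option.map_eq_some_iff, getElem?_initSeg_eq_some]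
      exact ⟨fun hm => ⟨n + 1, x n, ⟨n.lt_succ_self, rfl⟩, hm.symm⟩,
        fun ⟨_, _, ⟨_, hb⟩, hm⟩ => by rw [← hm, hb]⟩

theorem pair (hf : IsUseFunctional x φ f) (hg : IsUseFunctional x ψ g) :
    IsUseFunctional x (fun σ n => (φ σ n).bind fun a => (ψ σ n).map (Nat.pair a))
      (fun n => Nat.pair <$> f n <*> g n) where
  partrec := hf.partrec.bind <|
    (hg.partrec.comp (Computable.fst.comp Computable.fst) (Computable.snd.comp Computable.fst)).map
      (Primrec₂.natPair.to_comp.comp (Computable.snd.comp Computable.fst) Computable.snd)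
  limit n := by
    simpa [Seq.seq] using (hf.limit n).bind fun a => (hg.limit n).map (Nat.pair a)

theorem comp (hf : IsUseFunctional x φ f) (hg : IsUseFunctional x ψ g) :
    IsUseFunctional x (fun σ n => (ψ σ n).bind (φ σ)) (fun n => g n >>= f) where
  partrec := hg.partrec.bind <|
    hf.partrec.comp (Computable.fst.comp Computable.fst) Computable.snd
  limit n := (hg.limit n).bind hf.limit

theorem prec (hf : IsUseFunctional x φ f) (hg : IsUseFunctional x ψ g) :
    IsUseFunctional x
      (fun σ p => p.unpair.2.rec (φ σ p.unpair.1) fun y IH =>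
        IH.bind fun i => ψ σ (Nat.pair p.unpair.1 (Nat.pair y i)))
      (fun p => p.unpair.2.rec (f p.unpair.1) fun y IH =>
        IH.bind fun i => g (Nat.pair p.unpair.1 (Nat.pair y i))) where
  partrec := by
    have hunpair : Computable fun a : List Bool × ℕ => a.2.unpair :=
      Computable.unpair.comp Computable.snd
    refine Partrec.nat_rec (f := fun a : List Bool × ℕ => a.2.unpair.2)
      (g := fun a => φ a.1 a.2.unpair.1)
      (h := fun a b => ψ a.1 (Nat.pair a.2.unpair.1 (Nat.pair b.1 b.2)))
      (Computable.snd.comp hunpair)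
      (hf.partrec.comp Computable.fst (Computable.fst.comp hunpair))
      (hg.partrec.comp (Computable.fst.comp Computable.fst) ?_)
    exact Primrec₂.natPair.to_comp.comp (Computable.fst.comp (hunpair.comp Computable.fst))
      (Primrec₂.natPair.to_comp.comp (Computable.fst.comp Computable.snd)
        (Computable.snd.comp Computable.snd))
  limit _ := (hf.limit _).natRec (fun _ _ => hg.limit _) _

theorem rfind (hf : IsUseFunctional x φ f) :
    IsUseFunctional x
      (fun σ a => Nat.rfind fun n => (φ σ (Nat.pair a n)).map fun m => decide (m = 0))
      (fun a => Nat.rfind fun n => (f (Nat.pair a n)).map fun m => decide (m = 0)) where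
  partrec := by
    refine Partrec.rfind (p := fun (a : List Bool × ℕ) n =>
      (φ a.1 (Nat.pair a.2 n)).map fun m => decide (m = 0)) (Partrec.map
        (hf.partrec.comp (Computable.fst.comp Computable.fst) ?_) ?_)
    · exact Primrec₂.natPair.to_comp.comp (Computable.snd.comp Computable.fst) Computable.snd
    · exact ((Primrec.eq.comp Primrec.snd (Primrec.const 0)).decide).to_comp
  limit _ := .rfind fun _ => (hf.limit _).map _

end IsUseFunctional

theorem exists_isUseFunctional {x : Cantor} {f : ℕ →. ℕ}
    (hf : Nat.RecursiveIn {oracle x} f) : ∃ φ, IsUseFunctional x φ f := by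
  induction hf with
  | zero => exact ⟨_, .of_partrec (Partrec.nat_iff.2 .zero)⟩
  | succ => exact ⟨_, .of_partrec (Partrec.nat_iff.2 .succ)⟩
  | left => exact ⟨_, .of_partrec (Partrec.nat_iff.2 .left)⟩
  | right => exact ⟨_, .of_partrec (Partrec.nat_iff.2 .right)⟩
  | oracle g hg =>
    obtain rfl := hg
    exact ⟨_, .oracle⟩
  | pair _ _ ihf ihg =>
    obtain ⟨⟨φ, hφ⟩, ⟨ψ, hψ⟩⟩ := ihf, ihg
    exact ⟨_, hφ.pair hψ⟩
  | comp _ _ ihf ihg =>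
    obtain ⟨⟨φ, hφ⟩, ⟨ψ, hψ⟩⟩ := ihf, ihg
    exact ⟨_, hφ.comp hψ⟩
  | prec _ _ ihf ihg =>
    obtain ⟨⟨φ, hφ⟩, ⟨ψ, hψ⟩⟩ := ihf, ihg
    exact ⟨_, hφ.prec hψ⟩
  | rfind _ ih =>
    obtain ⟨φ, hφ⟩ := ih
    exact ⟨_, hφ.rfind⟩

/-! ### Functions computable relative to oracles -/

section ComputableIn

variable {α β γ : Type*} [Primcodable α] [Primcodable β] [Primcodable γ] {O : Set (ℕ →. ℕ)}

theorem recursiveIn_comp {f : β →. γ} {g : α → β} (hf : RecursiveIn O f) (hg : ComputableIn O g) :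
    RecursiveIn O fun a => f (g a) :=
  (Nat.RecursiveIn.comp hf hg).of_eq fun n => by cases decode (α := α) n <;> simp

theorem computableIn_comp {f : β → γ} {g : α → β} (hf : ComputableIn O f)
    (hg : ComputableIn O g) : ComputableIn O fun a => f (g a) :=
  recursiveIn_comp (f := fun b => Part.some (f b)) hf hg

theorem computableIn_pair {f : α → β} {g : α → γ} (hf : ComputableIn O f)
    (hg : ComputableIn O g) : ComputableIn O fun a => (f a, g a) :=
  (Nat.RecursiveIn.pair hf hg).of_eq fun n => by cases decode (α := α) n <;> simp [Seq.seq]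

theorem computableIn_natRec {step : ℕ × β → β} (hstep : ComputableIn O step) (b : β) :
    ComputableIn O fun n : ℕ => Nat.rec (motive := fun _ => β) b (fun k IH => step (k, IH)) n := by
  have hzero : Nat.RecursiveIn O fun n => Part.some (Nat.pair 0 n) :=
    (Primrec.nat_iff.1 (Primrec₂.natPair.comp (Primrec.const 0) Primrec.id)).recursiveIn
  have hbase : Nat.RecursiveIn O fun _ => Part.some (encode b) :=
    (Nat.Primrec.const (encode b)).recursiveIn
  refine (Nat.RecursiveIn.comp (.prec hbase (.comp hstep .right)) hzero).of_eq fun n => ?_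
  refine (Part.bind_some _ _).trans ?_
  simp only [Nat.unpair_pair, Part.bind_eq_bind, decode_nat, Part.coe_some, Part.bind_some,
    Part.map_some]
  induction n with
  | zero => rfl
  | succ n ih =>
    simp only at ih ⊢
    rw [ih]
    simp

theorem computableIn_find {p : ℕ → ℕ → Prop} [∀ n, DecidablePred (p n)]
    (hp : ComputableIn O fun a : ℕ × ℕ => decide (p a.1 a.2)) (hex : ∀ n, ∃ k, p n k) :
    ComputableIn O fun n => Nat.find (hex n) := by
  have htest : ComputableIn O fun a : ℕ × ℕ => cond (decide (p a.1 a.2)) 0 1 :=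
    computableIn_comp (f := fun b : Bool => cond b 0 1) (Primrec.dom_bool _).computableIn hp
  refine RecursiveIn.iff_nat.2 ((Nat.RecursiveIn.rfind htest).of_eq_tot fun n => ?_)
  have hspec := Nat.find_spec (hex n)
  have hmin := fun m (h : m < Nat.find (hex n)) => Nat.find_min (hex n) h
  exact Nat.mem_rfind.2 ⟨by simp [hspec], fun {m} hm => by simp [hmin m hm]⟩

theorem computableIn_iff_oracle {y : Cantor} : ComputableIn O y ↔ RecursiveIn O (oracle y) := by
  constructor
  · exact computableIn_comp (Primrec.dom_bool Bool.toNat).computableIn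
  · intro hy
    have hbit : PrimrecPred fun m : ℕ => m = 1 := Primrec.eq.comp Primrec.id (Primrec.const 1)
    have h := computableIn_comp (g := fun n => (y n).toNat) hbit.decide.computableIn hy
    simpa only [Bool.toNat_eq_one, Bool.decide_eq_true] using h

theorem computableIn_initSeg {y : Cantor} (hy : ComputableIn O y) :
    ComputableIn O (initSeg y) := by
  have happend : Primrec fun a : List Bool × Bool => a.1 ++ [a.2] :=
    Primrec.list_append.comp Primrec.fst (Primrec.list_cons.comp Primrec.snd (Primrec.const []))
  have hstep : ComputableIn O fun a : ℕ × List Bool => a.2 ++ [y a.1] :=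
    computableIn_comp happend.computableIn
      (computableIn_pair ComputableIn.snd (computableIn_comp hy ComputableIn.fst))
  refine (funext fun n => ?_ : initSeg y = _) ▸ computableIn_natRec hstep []
  induction n with
  | zero => rfl
  | succ n ih => rw [initSeg_succ, ih]

/-- To compute `y`, search for a certificate, that is, a string `c` accepted by the sound
criterion `C` for being an initial segment of `y`. -/
theorem computableIn_of_certificate {y : Cantor} {g : ℕ → β} {C : β → List Bool → Prop}
    (hg : ComputableIn O g) (hC : PrimrecRel C) (hex : ∀ n, ∃ k, C (g k) (initSeg y n))
    (hsound : ∀ k c, C (g k) c → y ∈ cylinder c) : ComputableIn O y := by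
  classical
  let cert (w : ℕ) : List Bool := (decode w.unpair.2).getD []
  have hcert : Primrec cert := Primrec.option_getD.comp
    (Primrec.decode.comp (Primrec.snd.comp Primrec.unpair)) (Primrec.const [])
  have hfound (n : ℕ) : ∃ w, C (g w.unpair.1) (cert w) ∧ n < (cert w).length := by
    obtain ⟨k, hk⟩ := hex (n + 1)
    exact ⟨Nat.pair k (encode (initSeg y (n + 1))), by simpa [cert] using hk⟩
  have haccept : PrimrecPred fun b : β × ℕ × ℕ =>
      C b.1 (cert b.2.2) ∧ b.2.1 < (cert b.2.2).length :=
    have hcert' : Primrec fun b : β × ℕ × ℕ => cert b.2.2 :=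
      hcert.comp (Primrec.snd.comp Primrec.snd)
    (hC.comp Primrec.fst hcert').and
      (Primrec.nat_lt.comp (Primrec.fst.comp Primrec.snd) (Primrec.list_length.comp hcert'))
  have hfind := computableIn_find (computableIn_comp haccept.decide.computableIn <|
    computableIn_pair (computableIn_comp hg <| computableIn_comp
      (Primrec.fst.comp Primrec.unpair).computableIn ComputableIn.snd) ComputableIn.id) hfound
  have hget : Primrec fun a : ℕ × ℕ => (cert a.2).getD a.1 false :=
    (Primrec.list_getD false).comp (hcert.comp Primrec.snd) Primrec.fst
  refine (funext fun n => ?_ : y = _) ▸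
    computableIn_comp hget.computableIn (computableIn_pair ComputableIn.id hfind)
  obtain ⟨hw, hn⟩ := Nat.find_spec (hfound n)
  rw [id, List.getD_eq_getElem _ _ hn]
  exact hsound _ _ hw n hn

end ComputableIn

/-! ### Codes of effectively open sets -/

section BoundedQuantifiers

variable {α β : Type*} [Primcodable α] [Primcodable β]

theorem primrecPred_forall_mem {l : α → List β} {R : α → β → Prop} (hl : Primrec l)
    (hR : PrimrecRel R) : PrimrecPred fun a => ∀ b ∈ l a, R a b :=
  (PrimrecRel.forall_mem_list (R := fun b a => R a b) (hR.comp Primrec.snd Primrec.fst)).comp hl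
    Primrec.id

theorem primrecPred_forall_lt {f : α → ℕ} {R : α → ℕ → Prop} (hf : Primrec f)
    (hR : PrimrecRel R) : PrimrecPred fun a => ∀ n < f a, R a n :=
  (primrecPred_forall_mem (Primrec.list_range.comp hf) hR).of_eq fun a => by simp

theorem primrecPred_exists_lt {f : α → ℕ} {R : α → ℕ → Prop} (hf : Primrec f)
    (hR : PrimrecRel R) : PrimrecPred fun a => ∃ n < f a, R a n :=
  (primrecPred_forall_lt (R := fun a n => ¬R a n) hf (PrimrecPred.not hR)).not.of_eq
    fun a => by simp

end BoundedQuantifiers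

open Nat.Partrec (Code)
open Nat.Partrec.Code (eval evaln)

theorem exists_code_eval_encode {α β : Type*} [Primcodable α] [Primcodable β] {g : α →. β}
    (hg : Partrec g) :
    ∃ e : ℕ, ∀ a, eval (Denumerable.ofNat Code e) (encode a) = (g a).map encode := by
  obtain ⟨c, hc⟩ := Nat.Partrec.Code.exists_code.1 hg
  exact ⟨encode c, fun a => by simp [hc]⟩

/-- Within `π.length` steps, the machine with number `e` and the finite part `π` of the oracle
enumerates the string `ρ` into its `i`-th open set. All initial segments `π.take j` are tried as
oracles, which makes the notion monotone in `π`. -/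
def Enumerates (e : ℕ) (π : List Bool) (i : ℕ) (ρ : List Bool) : Prop :=
  ∃ j < π.length + 1, ∃ s < π.length + 1,
    evaln π.length (Denumerable.ofNat Code e) (encode (π.take j, i, s)) = some (encode (some ρ))

theorem primrecPred_enumerates {α : Type*} [Primcodable α] {e i : α → ℕ} {π ρ : α → List Bool}
    (he : Primrec e) (hπ : Primrec π) (hi : Primrec i) (hρ : Primrec ρ) :
    PrimrecPred fun a => Enumerates (e a) (π a) (i a) (ρ a) := by
  have hlen : Primrec fun a => (π a).length := Primrec.list_length.comp hπ
  refine primrecPred_exists_lt (Primrec.succ.comp hlen) (primrecPred_exists_lt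
    (Primrec.succ.comp (hlen.comp Primrec.fst)) (Primrec.eq.comp ?_ ?_))
  · have ha : Primrec fun b : (α × ℕ) × ℕ => b.1.1 := Primrec.fst.comp Primrec.fst
    have hinput : Primrec fun b : (α × ℕ) × ℕ => ((π b.1.1).take b.1.2, i b.1.1, b.2) :=
      (Primrec.list_take.comp (Primrec.snd.comp Primrec.fst) (hπ.comp ha)).pair
        ((hi.comp ha).pair Primrec.snd)
    exact Nat.Partrec.Code.primrec_evaln.comp (((hlen.comp ha).pair
      ((Primrec.ofNat Code).comp (he.comp ha))).pair (Primrec.encode.comp hinput))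
  · exact Primrec.option_some.comp (Primrec.encode.comp (Primrec.option_some.comp
      (hρ.comp (Primrec.fst.comp Primrec.fst))))

theorem Enumerates.mono {e i : ℕ} {π π' ρ : List Bool} (h : Enumerates e π i ρ)
    (hp : π <+: π') : Enumerates e π' i ρ := by
  obtain ⟨j, hj, s, hs, h⟩ := h
  have hlen := hp.length_le
  have htake : π'.take j = π.take j := by
    obtain ⟨r, rfl⟩ := hp
    rw [List.take_append_of_le_length (by omega)]
  exact ⟨j, by omega, s, by omega, htake ▸ Nat.Partrec.Code.evaln_mono hlen h⟩

theorem exists_enumerates_initSeg_iff {e i : ℕ} {z : Cantor} {ρ : List Bool} :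
    (∃ k, Enumerates e (initSeg z k) i ρ) ↔
      ∃ k s : ℕ,
        encode (some ρ) ∈ eval (Denumerable.ofNat Code e) (encode (initSeg z k, i, s)) := by
  constructor
  · rintro ⟨k, j, hj, s, -, h⟩
    rw [length_initSeg] at hj
    rw [take_initSeg _ (by omega)] at h
    exact ⟨j, s, Nat.Partrec.Code.evaln_sound h⟩
  · rintro ⟨k, s, h⟩
    obtain ⟨n, hn⟩ := Nat.Partrec.Code.evaln_complete.1 h
    refine ⟨max n (max k s), k, by simp, s, by simp, ?_⟩
    rw [take_initSeg _ (by simp), length_initSeg]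
    exact Nat.Partrec.Code.evaln_mono (le_max_left _ _) hn

/-- The `i`-th open set enumerated by the machine with number `e` and the oracle `z`. -/
def effectiveOpen (e : ℕ) (z : Cantor) (i : ℕ) : Set Cantor :=
  {x | ∃ k j, Enumerates e (initSeg z k) i (initSeg x j)}

theorem UniformlySigma1In.exists_code {z : Cantor} {U : ℕ → Set Cantor}
    (hU : UniformlySigma1In {oracle z} U) : ∃ e, ∀ i, U i = effectiveOpen e z i := by
  obtain ⟨f, hf, hU⟩ := hU
  obtain ⟨φ, hφ⟩ := exists_isUseFunctional hf
  obtain ⟨e, he⟩ := exists_code_eval_encode (g := fun a : List Bool × ℕ × ℕ => φ a.1 (encode a.2))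
    (hφ.partrec.comp Computable.fst (Computable.encode.comp Computable.snd))
  have henum (i : ℕ) (ρ : List Bool) :
      (∃ s, f i s = some ρ) ↔ ∃ k, Enumerates e (initSeg z k) i ρ := by
    have hlimit (s : ℕ) := (hφ.limit (encode (i, s))).mem_iff (encode (some ρ))
    simp only [encodek, Part.coe_some, Part.bind_some, Part.map_some, Part.mem_some_iff,
      encode_inj] at hlimit
    rw [exists_enumerates_initSeg_iff, exists_comm]
    simp only [he, @eq_comm _ (f i _), hlimit]
    simp
  refine ⟨e, fun i => ?_⟩
  ext x
  simp only [hU, effectiveOpen, Set.mem_ofPred_eq]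
  rw [exists_comm, exists_comm (α := ℕ)]
  simp only [exists_and_right, henum, mem_cylinder_iff]
  exact ⟨fun ⟨ρ, h, hx⟩ => ⟨ρ.length, hx.symm ▸ h⟩, fun ⟨j, h⟩ => ⟨_, h, by simp⟩⟩

theorem uniformlySigma1In_of_primrecPred {O : Set (ℕ →. ℕ)} {z : Cantor}
    (hz : ComputableIn O z) {R : List Bool → ℕ → List Bool → Prop}
    (hR : PrimrecPred fun a : List Bool × ℕ × List Bool => R a.1 a.2.1 a.2.2) :
    UniformlySigma1In O fun i => {x | ∃ k j, R (initSeg z k) i (initSeg x j)} := by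
  classical
  let cert (s : ℕ) : List Bool := (decode s.unpair.2).getD []
  have hcert : Primrec cert := Primrec.option_getD.comp
    (Primrec.decode.comp (Primrec.snd.comp Primrec.unpair)) (Primrec.const [])
  have hselect : Primrec fun a : List Bool × ℕ × List Bool =>
      if R a.1 a.2.1 a.2.2 then some a.2.2 else none :=
    Primrec.ite hR (Primrec.option_some.comp (Primrec.snd.comp Primrec.snd)) (Primrec.const none)
  refine ⟨fun i s => if R (initSeg z s.unpair.1) i (cert s) then some (cert s) else none,
    computableIn_comp (g := fun a : ℕ × ℕ => (initSeg z a.2.unpair.1, a.1, cert a.2))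
      hselect.computableIn (computableIn_pair (computableIn_comp (computableIn_initSeg hz)
        (Primrec.fst.comp (Primrec.unpair.comp Primrec.snd)).computableIn)
      (Primrec.fst.pair (hcert.comp Primrec.snd)).computableIn), fun i => ?_⟩
  ext x
  simp only [Set.mem_ofPred_eq, mem_cylinder_iff]
  constructor
  · rintro ⟨k, j, h⟩
    exact ⟨Nat.pair k (encode (initSeg x j)), initSeg x j, by simp [cert, h], by simp⟩
  · rintro ⟨s, ρ, h, hx⟩
    split_ifs at h with hs
    exact ⟨s.unpair.1, ρ.length, by simpa only [hx, Option.some_inj.1 h] using hs⟩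

/-! ### Strings and the measure of clopen sets -/

/-- The list of all binary strings of length `n`. -/
def strings : ℕ → List (List Bool)
  | 0 => [[]]
  | n + 1 => (strings n).map (List.cons false) ++ (strings n).map (List.cons true)

theorem mem_strings {n : ℕ} {ρ : List Bool} : ρ ∈ strings n ↔ ρ.length = n := by
  induction n generalizing ρ with
  | zero => simp [strings]
  | succ n ih =>
    cases ρ with
    | nil => simp [strings]
    | cons b ρ => cases b <;> simp [strings, ih]

theorem length_strings (n : ℕ) : (strings n).length = 2 ^ n := by
  induction n with
  | zero => rfl
  | succ n ih => simp [strings, ih, pow_succ, mul_two]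

theorem primrec_strings : Primrec strings := by
  have hcons (b : Bool) : Primrec fun l : List (List Bool) => l.map (List.cons b) :=
    Primrec.list_map Primrec.id (Primrec.list_cons.comp (Primrec.const b) Primrec.snd)
  refine (Primrec.nat_rec₁ [[]] (f := fun _ l => l.map (List.cons false) ++ l.map (List.cons true))
    (Primrec.list_append.comp ((hcons false).comp Primrec.snd)
      ((hcons true).comp Primrec.snd))).of_eq fun n => ?_
  induction n with
  | zero => rfl
  | succ n ih => simp only [strings, ← ih]

theorem measurableSet_initSeg (P : List Bool → Prop) (m : ℕ) :
    MeasurableSet {x : Cantor | P (initSeg x m)} := by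
  have hlocal : {x : Cantor | P (initSeg x m)} = (Finset.range m).restrict ⁻¹'
      {u | P (initSeg (fun i => if h : i ∈ Finset.range m then u ⟨i, h⟩ else false) m)} := by
    ext x
    have hrestrict : initSeg (fun i => if i ∈ Finset.range m then x i else false) m =
        initSeg x m := List.map_congr_left fun i hi => by simp [List.mem_range.1 hi]
    exact iff_of_eq (congrArg P hrestrict.symm)
  rw [hlocal]
  exact Finset.measurable_restrict _ MeasurableSet.of_discrete

theorem measurableSet_cylinder (σ : List Bool) : MeasurableSet (cylinder σ) := by
  exact (Set.ext fun _ => mem_cylinder_iff : cylinder σ = _) ▸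
    measurableSet_initSeg (· = σ) σ.length

open Classical in
theorem measureReal_cylinder_inter (μ : Measure Cantor) [IsFiniteMeasure μ]
    (P : List Bool → Prop) (n : ℕ) (τ : List Bool) :
    μ.real (cylinder τ ∩ {x | P (initSeg x (τ.length + n))}) =
      ((strings n).map fun ρ => if P (τ ++ ρ) then μ.real (cylinder (τ ++ ρ)) else 0).sum := by
  induction n generalizing τ with
  | zero =>
    have hP : cylinder τ ∩ {x | P (initSeg x (τ.length + 0))} = {x ∈ cylinder τ | P τ} := by
      ext x
      exact and_congr_right fun h => by simp [mem_cylinder_iff.1 h]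
    rw [hP]
    by_cases h : P τ <;> simp [strings, h]
  | succ n ih =>
    have hsplit : cylinder τ ∩ {x | P (initSeg x (τ.length + (n + 1)))} =
        cylinder (τ ++ [false]) ∩ {x | P (initSeg x ((τ ++ [false]).length + n))} ∪
          cylinder (τ ++ [true]) ∩ {x | P (initSeg x ((τ ++ [true]).length + n))} := by
      ext x
      simp only [Set.mem_inter_iff, Set.mem_union, mem_cylinder_concat, Set.mem_ofPred_eq,
        List.length_append, List.length_singleton, add_assoc, add_comm 1 n]
      cases x τ.length <;> simp
    rw [hsplit, measureReal_union ?_ ((measurableSet_cylinder _).inter (measurableSet_initSeg _ _)),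
      ih, ih]
    · simp [strings, Function.comp_def]
    · rw [Set.disjoint_left]
      rintro x ⟨hx, -⟩ ⟨hx', -⟩
      simp [mem_cylinder_concat] at hx hx'
      simp [hx.2] at hx'

instance (p : unitInterval) : IsProbabilityMeasure (bernoulli p) := by
  unfold bernoulli; infer_instance

theorem bernoulli_real_cylinder (p : unitInterval) (σ : List Bool) :
    (bernoulli p).real (cylinder σ) =
      (p : ℝ) ^ σ.count false * (1 - (p : ℝ)) ^ σ.count true := by
  rw [Measure.real, bernoulli_cylinder, ENNReal.toReal_ofReal]
  exact mul_nonneg (pow_nonneg p.2.1 _) (pow_nonneg (sub_nonneg.2 p.2.2) _)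

/-! ### Approximating the Bernoulli measure from the binary expansion -/

/-- The natural number with the given binary digits, the most significant one first. -/
def binaryValue (π : List Bool) : ℕ := π.foldl (fun a b => 2 * a + b.toNat) 0

theorem binaryValue_concat (π : List Bool) (b : Bool) :
    binaryValue (π ++ [b]) = 2 * binaryValue π + b.toNat := by
  simp [binaryValue]

theorem primrec_binaryValue : Primrec binaryValue :=
  Primrec.list_foldl (h := fun (_ : List Bool) (s : ℕ × Bool) => 2 * s.1 + s.2.toNat)
    Primrec.id (Primrec.const 0) <| Primrec.nat_add.comp
      (Primrec.nat_mul.comp (Primrec.const 2) (Primrec.fst.comp Primrec.snd))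
      ((Primrec.dom_bool _).comp (Primrec.snd.comp Primrec.snd))

theorem binaryValue_initSeg {p : unitInterval} (hp : p < 1) (t : ℕ) :
    binaryValue (initSeg (binaryExpansion p) t) = ⌊(p : ℝ) * 2 ^ t⌋₊ := by
  induction t with
  | zero => simp [initSeg, binaryValue, Nat.floor_eq_zero.2 (show (p : ℝ) < 1 from hp)]
  | succ t ih =>
    have hbit : (binaryExpansion p t).toNat = ⌊(p : ℝ) * 2 ^ (t + 1)⌋₊ % 2 := by
      rcases Nat.mod_two_eq_zero_or_one ⌊(p : ℝ) * 2 ^ (t + 1)⌋₊ with h | h <;>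
        simp [binaryExpansion, Real.digits, Fin.ext_iff, h]
    have hhalf : ⌊(p : ℝ) * 2 ^ t⌋₊ = ⌊(p : ℝ) * 2 ^ (t + 1)⌋₊ / 2 := by
      rw [← Nat.floor_div_natCast, pow_succ, ← mul_assoc, Nat.cast_ofNat,
        mul_div_cancel_right₀ _ two_ne_zero]
    rw [initSeg_succ, binaryValue_concat, ih, hbit, hhalf, Nat.div_add_mod]

/-- `2 ^ (π.length * σ.length)` times the measure of `cylinder σ`, approximated from above on the
basis of an initial segment `π` of the binary expansion of the parameter. -/
def weight (π σ : List Bool) : ℕ :=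
  (binaryValue π + 1) ^ σ.count false * (2 ^ π.length - binaryValue π) ^ σ.count true

theorem primrec_pow : Primrec₂ ((· ^ ·) : ℕ → ℕ → ℕ) := Primrec₂.unpaired'.1 Nat.Primrec.pow

theorem primrec_count (b : Bool) : Primrec fun σ : List Bool => σ.count b :=
  (Primrec.list_length.comp (Primrec.listFilter (Primrec.eq.comp Primrec.id
    (Primrec.const b)))).of_eq fun σ => by rw [List.count_eq_length_filter]; congr 2

theorem primrec_weight : Primrec₂ weight :=
  have hvalue : Primrec fun a : List Bool × List Bool => binaryValue a.1 :=
    primrec_binaryValue.comp Primrec.fst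
  Primrec.nat_mul.comp
    (primrec_pow.comp (Primrec.succ.comp hvalue) ((primrec_count _).comp Primrec.snd))
    (primrec_pow.comp (Primrec.nat_sub.comp (primrec_pow.comp (Primrec.const 2)
      (Primrec.list_length.comp Primrec.fst)) hvalue) ((primrec_count _).comp Primrec.snd))

section Weight

variable {p : unitInterval}

theorem binaryValue_initSeg_le (hp : p < 1) (t : ℕ) :
    (binaryValue (initSeg (binaryExpansion p) t) : ℝ) ≤ p * 2 ^ t := by
  rw [binaryValue_initSeg hp]
  exact Nat.floor_le (mul_nonneg p.2.1 (by positivity))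

theorem lt_binaryValue_initSeg_add_one (hp : p < 1) (t : ℕ) :
    p * 2 ^ t < (binaryValue (initSeg (binaryExpansion p) t) : ℝ) + 1 := by
  rw [binaryValue_initSeg hp]
  exact Nat.lt_floor_add_one _

theorem weight_initSeg_div (hp : p < 1) (t : ℕ) (σ : List Bool) :
    (weight (initSeg (binaryExpansion p) t) σ : ℝ) / 2 ^ (t * σ.length) =
      (binaryValue (initSeg (binaryExpansion p) t) / 2 ^ t + (2 ^ t)⁻¹ : ℝ) ^ σ.count false *
        (1 - binaryValue (initSeg (binaryExpansion p) t) / 2 ^ t : ℝ) ^ σ.count true := by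
  have hle : binaryValue (initSeg (binaryExpansion p) t) ≤ 2 ^ t := by
    have h := (binaryValue_initSeg_le hp t).trans
      (mul_le_of_le_one_left (by positivity) p.2.2)
    exact_mod_cast h
  rw [weight, length_initSeg, ← List.count_false_add_count_true σ, mul_add, pow_add, pow_mul,
    pow_mul]
  push_cast [Nat.cast_sub hle]
  rw [← one_div, ← add_div, one_sub_div (by positivity), div_pow, div_pow, div_mul_div_comm]

theorem real_cylinder_le_weight_div (hp : p < 1) (t : ℕ) (σ : List Bool) :
    (bernoulli p).real (cylinder σ) ≤
      weight (initSeg (binaryExpansion p) t) σ / 2 ^ (t * σ.length) := by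
  rw [bernoulli_real_cylinder, weight_initSeg_div hp]
  have hlower := (div_le_iff₀ (by positivity)).2 (binaryValue_initSeg_le hp t)
  have hupper := (lt_div_iff₀ (by positivity)).2 (lt_binaryValue_initSeg_add_one hp t)
  rw [add_div, one_div] at hupper
  have hp₀ : (0 : ℝ) ≤ p := p.2.1
  have hp₁ : (0 : ℝ) ≤ 1 - p := sub_nonneg.2 p.2.2
  gcongr

theorem tendsto_weight_div (hp : p < 1) (σ : List Bool) :
    Tendsto (fun t => (weight (initSeg (binaryExpansion p) t) σ : ℝ) / 2 ^ (t * σ.length)) atTop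
      (𝓝 ((bernoulli p).real (cylinder σ))) := by
  have hpow : Tendsto (fun t : ℕ => (2 : ℝ) ^ t) atTop atTop :=
    tendsto_pow_atTop_atTop_of_one_lt one_lt_two
  have hvalue : Tendsto
      (fun t => (binaryValue (initSeg (binaryExpansion p) t) : ℝ) / 2 ^ t) atTop (𝓝 p) := by
    simp only [binaryValue_initSeg hp]
    exact (tendsto_nat_floor_mul_div_atTop p.2.1).comp hpow
  simp only [weight_initSeg_div hp, bernoulli_real_cylinder]
  have hupper := hvalue.add hpow.inv_tendsto_atTop
  rw [add_zero] at hupper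
  exact (hupper.pow _).mul ((tendsto_const_nhds.sub hvalue).pow _)

end Weight

/-! ### Strings in which little measure survives -/

theorem primrec_list_sum : Primrec (List.sum : List ℕ → ℕ) :=
  Primrec.list_foldr (h := fun (_ : List ℕ) (b : ℕ × ℕ) => b.1 + b.2) Primrec.id
    (Primrec.const 0) (Primrec.nat_add.comp (Primrec.fst.comp Primrec.snd)
      (Primrec.snd.comp Primrec.snd))

open Classical in
/-- `2 ^ (π.length * (τ.length + m))` times an upper approximation to the measure of the part of
`cylinder τ` that, judging from the first `τ.length + m` bits and the finite part `π` of the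
oracle, is not covered. -/
noncomputable def survivingWeight (C : List Bool → List Bool → Prop) (π : List Bool) (m : ℕ)
    (τ : List Bool) : ℕ :=
  ((strings m).map fun ρ => if C π (τ ++ ρ) then 0 else weight π (τ ++ ρ)).sum

theorem primrec_survivingWeight {α : Type*} [Primcodable α]
    {C : α → List Bool → List Bool → Prop} {π τ : α → List Bool} {m : α → ℕ}
    (hC : PrimrecPred fun a : α × List Bool × List Bool => C a.1 a.2.1 a.2.2)
    (hπ : Primrec π) (hm : Primrec m) (hτ : Primrec τ) :
    Primrec fun a => survivingWeight (C a) (π a) (m a) (τ a) := by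
  classical
  have hπ' : Primrec fun b : α × List Bool => π b.1 := hπ.comp Primrec.fst
  have hstring : Primrec fun b : α × List Bool => τ b.1 ++ b.2 :=
    Primrec.list_append.comp (hτ.comp Primrec.fst) Primrec.snd
  exact primrec_list_sum.comp (Primrec.list_map (primrec_strings.comp hm) (Primrec.ite
    (hC.comp (Primrec.fst.pair (hπ'.pair hstring))) (Primrec.const 0)
    (primrec_weight.comp hπ' hstring)))

section Surviving

variable {p : unitInterval}

theorem real_inter_le_survivingWeight_div (hp : p < 1) (C : List Bool → List Bool → Prop)
    (t m : ℕ) (τ : List Bool) :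
    (bernoulli p).real (cylinder τ ∩
        {x | ¬C (initSeg (binaryExpansion p) t) (initSeg x (τ.length + m))}) ≤
      survivingWeight C (initSeg (binaryExpansion p) t) m τ / 2 ^ (t * (τ.length + m)) := by
  rw [measureReal_cylinder_inter _ (fun σ => ¬C (initSeg (binaryExpansion p) t) σ),
    survivingWeight, Nat.cast_list_sum, div_eq_mul_inv, ← List.sum_map_mul_right, List.map_map]
  refine List.sum_le_sum fun ρ hρ => ?_
  by_cases hc : C (initSeg (binaryExpansion p) t) (τ ++ ρ)
  · simp [hc]
  · simpa [hc, mem_strings.1 hρ, div_eq_mul_inv] using real_cylinder_le_weight_div hp t (τ ++ ρ)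

theorem tendsto_survivingWeight_div (hp : p < 1) (P : List Bool → Prop) (m : ℕ) (τ : List Bool) :
    Tendsto (fun t => (survivingWeight (fun _ => P) (initSeg (binaryExpansion p) t) m τ : ℝ) /
        2 ^ (t * (τ.length + m))) atTop
      (𝓝 ((bernoulli p).real (cylinder τ ∩ {x | ¬P (initSeg x (τ.length + m))}))) := by
  simp only [measureReal_cylinder_inter _ (fun σ => ¬P σ), survivingWeight, Nat.cast_list_sum,
    div_eq_mul_inv, ← List.sum_map_mul_right, List.map_map]
  refine tendsto_list_sum _ fun ρ hρ => ?_
  by_cases hc : P (τ ++ ρ)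
  · simp [hc]
  · simpa [hc, mem_strings.1 hρ, div_eq_mul_inv] using tendsto_weight_div hp (τ ++ ρ)

theorem survivingWeight_mono {C D : List Bool → List Bool → Prop} {π : List Bool} {m : ℕ}
    {τ : List Bool} (hCD : ∀ ρ, C π ρ → D π ρ) :
    survivingWeight D π m τ ≤ survivingWeight C π m τ := by
  refine List.sum_le_sum fun ρ _ => ?_
  by_cases hc : C π (τ ++ ρ)
  · simp [hc, hCD _ hc]
  · simp only [hc, if_false]
    split_ifs <;> simp

theorem measure_diff_lt_iff_exists_survivingWeight_lt (hp : p < 1)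
    {C : List Bool → List Bool → Prop}
    (hC : ∀ {π π' ρ ρ'}, C π ρ → π <+: π' → ρ <+: ρ' → C π' ρ') (τ : List Bool) (c : ℝ) :
    (bernoulli p).real
        (cylinder τ \ {x | ∃ k m, C (initSeg (binaryExpansion p) k) (initSeg x m)}) < c ↔
      ∃ t m, (survivingWeight C (initSeg (binaryExpansion p) t) m τ : ℝ) /
        2 ^ (t * (τ.length + m)) < c := by
  set z := binaryExpansion p
  set A : ℕ → Set Cantor := fun n =>
    cylinder τ ∩ {x | ¬C (initSeg z n) (initSeg x (τ.length + n))}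
  have hanti : Antitone A := fun s t hst x hx => ⟨hx.1, fun hc => hx.2 <|
    hC hc (initSeg_prefix _ hst) (initSeg_prefix _ (by omega))⟩
  have hinter : ⋂ n, A n = cylinder τ \ {x | ∃ k m, C (initSeg z k) (initSeg x m)} := by
    ext x
    simp only [A, Set.mem_iInter, Set.mem_sdiff, Set.mem_inter_iff, Set.mem_ofPred_eq, forall_and,
      forall_const, not_exists]
    exact and_congr_right fun _ => ⟨fun hx k m hc => hx (max k m) <|
      hC hc (initSeg_prefix _ (le_max_left _ _)) (initSeg_prefix _ (by omega)), fun hx n => hx _ _⟩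
  have hmeas (n : ℕ) : NullMeasurableSet (A n) (bernoulli p) := ((measurableSet_cylinder τ).inter
    (measurableSet_initSeg (fun σ => ¬C (initSeg z n) σ) _)).nullMeasurableSet
  have hlim : Tendsto (fun n => (bernoulli p).real (A n)) atTop
      (𝓝 ((bernoulli p).real (⋂ n, A n))) := (ENNReal.tendsto_toReal (measure_ne_top _ _)).comp
    (tendsto_measure_iInter_atTop hmeas hanti ⟨0, measure_ne_top _ _⟩)
  rw [← hinter]
  constructor
  · intro h
    obtain ⟨n, hn⟩ := (hlim.eventually_lt_const h).exists
    obtain ⟨t, hnt, ht⟩ := ((eventually_ge_atTop n).and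
      ((tendsto_survivingWeight_div hp (C (initSeg z n)) n τ).eventually_lt_const hn)).exists
    refine ⟨t, n, lt_of_le_of_lt ?_ ht⟩
    gcongr
    exact survivingWeight_mono fun ρ hc => hC hc (initSeg_prefix _ hnt) List.prefix_rfl
  · rintro ⟨t, m, h⟩
    refine ((real_inter_le_survivingWeight_div hp C t m τ).trans' (measureReal_mono ?_)).trans_lt h
    rw [hinter]
    exact fun x hx => ⟨hx.1, fun hc => hx.2 ⟨t, _, hc⟩⟩

end Surviving

/-- The exponent of the bound `2⁻¹ ^ stageExponent K n` for the measure kept at stage `n`. -/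
def stageExponent (K n : ℕ) : ℕ := 2 * K ^ (n + 1)

theorem primrec_stageExponent (K : ℕ) : Primrec (stageExponent K) :=
  Primrec.nat_mul.comp (Primrec.const 2) (primrec_pow.comp (Primrec.const K) Primrec.succ)

/-- The open set forbidden by the history `h`: the bit of `h` at position `2 * e` says whether the
`e`-th effectively open sequence is a test, to be avoided from then on. -/
def forbidden (K : ℕ) (z : Cantor) (h : List Bool) : Set Cantor :=
  {x | ∃ e, h.getD (2 * e) false = true ∧ x ∈ effectiveOpen e z (stageExponent K (2 * e + 1))}

/-- The string `ρ` is seen, with the finite part `π` of the oracle, to lie in the open set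
forbidden by the history `h`. -/
def Covered (K : ℕ) (h π ρ : List Bool) : Prop :=
  ∃ e < h.length, h.getD (2 * e) false = true ∧ ∃ j < ρ.length + 1,
    Enumerates e π (stageExponent K (2 * e + 1)) (ρ.take j)

theorem Covered.mono {K : ℕ} {h π π' ρ ρ' : List Bool} (hc : Covered K h π ρ)
    (hπ : π <+: π') (hρ : ρ <+: ρ') : Covered K h π' ρ' := by
  obtain ⟨e, he, hb, j, hj, hc⟩ := hc
  have hlen := hρ.length_le
  refine ⟨e, he, hb, j, by omega, ?_⟩
  obtain ⟨r, rfl⟩ := hρ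
  rw [List.take_append_of_le_length (by omega)]
  exact hc.mono hπ

theorem setOf_covered_eq_forbidden (K : ℕ) (z : Cantor) (h : List Bool) :
    {x | ∃ k m, Covered K h (initSeg z k) (initSeg x m)} = forbidden K z h := by
  ext x
  constructor
  · rintro ⟨k, m, e, -, hb, j, hj, henum⟩
    rw [length_initSeg] at hj
    rw [take_initSeg _ (by omega)] at henum
    exact ⟨e, hb, k, j, henum⟩
  · rintro ⟨e, hb, k, j, henum⟩
    have he : e < h.length := by
      by_contra hlt
      rw [List.getD_eq_default _ _ (by omega)] at hb
      exact absurd hb Bool.false_ne_true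
    exact ⟨k, j, e, he, hb, j, by simp, by rwa [take_initSeg _ le_rfl]⟩

theorem primrecPred_covered {α : Type*} [Primcodable α] (K : ℕ) {h π ρ : α → List Bool}
    (hh : Primrec h) (hπ : Primrec π) (hρ : Primrec ρ) :
    PrimrecPred fun a => Covered K (h a) (π a) (ρ a) := by
  have hbit : Primrec fun b : α × ℕ => (h b.1).getD (2 * b.2) false :=
    (Primrec.list_getD false).comp (hh.comp Primrec.fst) (Primrec.nat_double.comp Primrec.snd)
  have he : Primrec fun c : (α × ℕ) × ℕ => c.1.2 := Primrec.snd.comp Primrec.fst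
  have ha : Primrec fun c : (α × ℕ) × ℕ => c.1.1 := Primrec.fst.comp Primrec.fst
  exact primrecPred_exists_lt (Primrec.list_length.comp hh) <|
    (Primrec.eq.comp hbit (Primrec.const true)).and <|
      primrecPred_exists_lt (Primrec.succ.comp (Primrec.list_length.comp (hρ.comp Primrec.fst))) <|
        primrecPred_enumerates he (hπ.comp ha)
          ((primrec_stageExponent K).comp (Primrec.nat_double_succ.comp he))
          (Primrec.list_take.comp Primrec.snd (hρ.comp ha))

/-- The finite part `π` of the oracle shows that less than twice the measure to be kept at the next
stage survives in the cylinder of `τ` when the set forbidden by the history `h` is removed. -/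
def Dead (K : ℕ) (π h τ : List Bool) : Prop :=
  ∃ t < π.length + 1, ∃ m < π.length + 1,
    survivingWeight (Covered K h) (π.take t) m τ * 2 ^ stageExponent K (h.length + 1) <
      2 * 2 ^ (t * (τ.length + m))

theorem Dead.mono {K : ℕ} {π π' h τ : List Bool} (hd : Dead K π h τ) (hπ : π <+: π') :
    Dead K π' h τ := by
  obtain ⟨t, ht, m, hm, hlt⟩ := hd
  have hlen := hπ.length_le
  refine ⟨t, by omega, m, by omega, ?_⟩
  obtain ⟨r, rfl⟩ := hπ
  rwa [List.take_append_of_le_length (by omega)]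

theorem primrecPred_dead {α : Type*} [Primcodable α] (K : ℕ) {π h τ : α → List Bool}
    (hπ : Primrec π) (hh : Primrec h) (hτ : Primrec τ) :
    PrimrecPred fun a => Dead K (π a) (h a) (τ a) := by
  have hlen : Primrec fun a => (π a).length + 1 :=
    Primrec.succ.comp (Primrec.list_length.comp hπ)
  have ha : Primrec fun c : (α × ℕ) × ℕ => c.1.1 := Primrec.fst.comp Primrec.fst
  have ht : Primrec fun c : (α × ℕ) × ℕ => c.1.2 := Primrec.snd.comp Primrec.fst
  refine primrecPred_exists_lt hlen (primrecPred_exists_lt (hlen.comp Primrec.fst)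
    (Primrec.nat_lt.comp (Primrec.nat_mul.comp ?_ ?_) ?_))
  · exact primrec_survivingWeight (C := fun c : (α × ℕ) × ℕ => Covered K (h c.1.1))
      (primrecPred_covered K (hh.comp (ha.comp Primrec.fst)) (Primrec.fst.comp Primrec.snd)
        (Primrec.snd.comp Primrec.snd))
      (Primrec.list_take.comp ht (hπ.comp ha)) Primrec.snd (hτ.comp ha)
  · exact primrec_pow.comp (Primrec.const 2) ((primrec_stageExponent K).comp
      (Primrec.succ.comp (Primrec.list_length.comp (hh.comp ha))))
  · exact Primrec.nat_mul.comp (Primrec.const 2) (primrec_pow.comp (Primrec.const 2)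
      (Primrec.nat_mul.comp ht (Primrec.nat_add.comp (Primrec.list_length.comp (hτ.comp ha))
        Primrec.snd)))

theorem exists_dead_initSeg_iff {p : unitInterval} (hp : p < 1) {K : ℕ} {h τ : List Bool} :
    (∃ k, Dead K (initSeg (binaryExpansion p) k) h τ) ↔
      (bernoulli p).real (cylinder τ \ forbidden K (binaryExpansion p) h) *
        2 ^ stageExponent K (h.length + 1) < 2 := by
  rw [← lt_div_iff₀ (by positivity), ← setOf_covered_eq_forbidden,
    measure_diff_lt_iff_exists_survivingWeight_lt hp Covered.mono]
  have hscale (t m : ℕ) : (survivingWeight (Covered K h) (initSeg (binaryExpansion p) t) m τ : ℝ) /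
        2 ^ (t * (τ.length + m)) < 2 / 2 ^ stageExponent K (h.length + 1) ↔
      survivingWeight (Covered K h) (initSeg (binaryExpansion p) t) m τ *
        2 ^ stageExponent K (h.length + 1) < 2 * 2 ^ (t * (τ.length + m)) := by
    rw [div_lt_div_iff₀ (by positivity) (by positivity)]
    norm_cast
  simp only [hscale]
  constructor
  · rintro ⟨k, t, ht, m, hm, hlt⟩
    rw [length_initSeg] at ht
    rw [take_initSeg _ (by omega)] at hlt
    exact ⟨t, m, hlt⟩
  · rintro ⟨t, m, hlt⟩
    refine ⟨max t m, t, by simp, m, by simp, ?_⟩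
    rwa [take_initSeg _ (le_max_left _ _)]

/-! ### Coding one bit -/

/-- The list of all strings of length `l` that extend `σ`, provided that `σ.length ≤ l`. -/
def extensions (σ : List Bool) (l : ℕ) : List (List Bool) :=
  (strings (l - σ.length)).map (σ ++ ·)

theorem mem_extensions {σ τ : List Bool} {l : ℕ} (hl : σ.length ≤ l) :
    τ ∈ extensions σ l ↔ σ <+: τ ∧ τ.length = l := by
  simp only [extensions, List.mem_map, mem_strings]
  constructor
  · rintro ⟨ρ, hρ, rfl⟩
    exact ⟨List.prefix_append _ _, by rw [List.length_append]; omega⟩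
  · rintro ⟨⟨ρ, rfl⟩, hτ⟩
    rw [List.length_append] at hτ
    exact ⟨ρ, by omega, rfl⟩

theorem primrec_extensions : Primrec₂ extensions :=
  Primrec.list_map (primrec_strings.comp (Primrec.nat_sub.comp Primrec.snd
      (Primrec.list_length.comp Primrec.fst)))
    (Primrec.list_append.comp (Primrec.fst.comp Primrec.fst) Primrec.snd)

theorem cylinder_subset_biUnion_extensions {σ : List Bool} {l : ℕ} (hl : σ.length ≤ l) :
    cylinder σ ⊆ ⋃ τ ∈ (extensions σ l).toFinset, cylinder τ := by
  intro x hx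
  have hprefix : σ <+: initSeg x l := mem_cylinder_iff.1 hx ▸ initSeg_prefix x hl
  simp only [Set.mem_iUnion, List.mem_toFinset, mem_extensions hl]
  exact ⟨initSeg x l, ⟨hprefix, length_initSeg x l⟩, mem_cylinder_iff.2 (by simp)⟩

theorem sum_le_card_filter_mul_add_card_mul {ι : Type*} {S : Finset ι} {P : ι → Prop}
    [DecidablePred P] {f : ι → ℝ} {a b : ℝ} (ha : ∀ i ∈ S, f i ≤ a)
    (hb₀ : 0 ≤ b) (hb : ∀ i ∈ S, ¬P i → f i ≤ b) :
    ∑ i ∈ S, f i ≤ (S.filter P).card * a + S.card * b := by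
  rw [← Finset.sum_filter_add_sum_filter_not S P]
  refine add_le_add ?_ ?_
  · simpa using Finset.sum_le_card_nsmul _ _ a fun i hi => ha i (Finset.mem_filter.1 hi).1
  · have h := Finset.sum_le_card_nsmul (S.filter fun i => ¬P i) f b fun i hi =>
      hb i (Finset.mem_filter.1 hi).1 (Finset.mem_filter.1 hi).2
    rw [nsmul_eq_mul] at h
    refine h.trans ?_
    gcongr
    exact Finset.filter_subset _ _

theorem one_le_of_one_le_natCast_mul {N : ℕ} {r : ℝ} (h : 1 ≤ N * r) : 1 ≤ N :=
  Nat.one_le_iff_ne_zero.2 fun hN => by norm_num [hN] at h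

section Spread

variable {p : unitInterval} {N : ℕ}

theorem real_cylinder_le_two_inv_pow (hN₀ : 1 ≤ N * (p : ℝ)) (hN₁ : 1 ≤ N * (1 - (p : ℝ)))
    {m : ℕ} {τ : List Bool} (hτ : τ.length = N * m) :
    (bernoulli p).real (cylinder τ) ≤ 2⁻¹ ^ m := by
  have hp₀ : (0 : ℝ) ≤ p := p.2.1
  have hp₁ : (0 : ℝ) ≤ 1 - p := sub_nonneg.2 p.2.2
  have hN : (0 : ℝ) < N := by
    by_contra! hN
    linarith [mul_nonpos_of_nonpos_of_nonneg hN hp₀]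
  have hinv₀ : (N : ℝ)⁻¹ ≤ p := by rwa [inv_le_iff_one_le_mul₀' hN]
  have hinv₁ : (N : ℝ)⁻¹ ≤ 1 - p := by rwa [inv_le_iff_one_le_mul₀' hN]
  have hexp : 1 - (N : ℝ)⁻¹ ≤ Real.exp (-(N : ℝ)⁻¹) := Real.one_sub_le_exp_neg _
  have hexp₀ : (p : ℝ) ≤ Real.exp (-(N : ℝ)⁻¹) := by linarith
  have hexp₁ : 1 - (p : ℝ) ≤ Real.exp (-(N : ℝ)⁻¹) := by linarith
  calc (bernoulli p).real (cylinder τ)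
      = (p : ℝ) ^ τ.count false * (1 - (p : ℝ)) ^ τ.count true := bernoulli_real_cylinder p τ
    _ ≤ Real.exp (-(N : ℝ)⁻¹) ^ τ.count false * Real.exp (-(N : ℝ)⁻¹) ^ τ.count true := by gcongr
    _ = Real.exp (-(N : ℝ)⁻¹) ^ (N * m) := by
        rw [← pow_add, List.count_false_add_count_true, hτ]
    _ = Real.exp (-1) ^ m := by
        rw [pow_mul, ← Real.exp_nat_mul, mul_neg, mul_inv_cancel₀ hN.ne']
    _ ≤ 2⁻¹ ^ m := by
        rw [Real.exp_neg]
        gcongr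
        linarith [Real.add_one_le_exp 1]

theorem two_inv_pow_add_mul_two_pow_lt_one {l c : ℕ} (hl : 1 ≤ l) (hc : 3 ≤ c) :
    ((2⁻¹ : ℝ) ^ (4 * l) + 2 ^ c * (2 * 2⁻¹ ^ (2 * (l + c)))) * 2 ^ (2 * l) < 1 := by
  have hcancel (n : ℕ) : (2 : ℝ) ^ n * 2⁻¹ ^ n = 1 := by
    rw [← mul_pow, mul_inv_cancel₀ two_ne_zero, one_pow]
  have hsmall {m n : ℕ} (h : m ≤ n) : (2⁻¹ : ℝ) ^ n ≤ 2⁻¹ ^ m :=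
    pow_le_pow_of_le_one (by norm_num) (by norm_num) h
  calc ((2⁻¹ : ℝ) ^ (4 * l) + 2 ^ c * (2 * 2⁻¹ ^ (2 * (l + c)))) * 2 ^ (2 * l)
      = 2⁻¹ ^ (2 * l) * (2 ^ (2 * l) * 2⁻¹ ^ (2 * l)) +
          2 * 2⁻¹ ^ c * (2 ^ c * 2⁻¹ ^ c) * (2 ^ (2 * l) * 2⁻¹ ^ (2 * l)) := by
        rw [show 4 * l = 2 * l + 2 * l by ring, show 2 * (l + c) = 2 * l + (c + c) by ring,
          pow_add, pow_add, pow_add]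
        ring
    _ = 2⁻¹ ^ (2 * l) + 2 * 2⁻¹ ^ c := by simp only [hcancel, mul_one]
    _ ≤ 2⁻¹ ^ 2 + 2 * 2⁻¹ ^ 3 :=
        add_le_add (hsmall (by omega)) (mul_le_mul_of_nonneg_left (hsmall hc) zero_le_two)
    _ < 1 := by norm_num

open Classical in
/-- Each extension has measure at most `2⁻¹ ^ (4 * σ.length)`, so a single one cannot make up for
what is lost when all the others are light. -/
theorem one_lt_card_filter_extensions (hN₀ : 1 ≤ N * (p : ℝ)) (hN₁ : 1 ≤ N * (1 - (p : ℝ)))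
    {σ : List Bool} {l : ℕ} (hσ : 1 ≤ σ.length) (hl : l = N * (4 * σ.length)) {F : Set Cantor}
    (hF : 1 ≤ (bernoulli p).real (cylinder σ \ F) * 2 ^ (2 * σ.length)) :
    1 < ((extensions σ l).toFinset.filter fun τ =>
      2 ≤ (bernoulli p).real (cylinder τ \ F) * 2 ^ (2 * l)).card := by
  by_contra! hcard
  have hN : 1 ≤ N := one_le_of_one_le_natCast_mul hN₀
  obtain ⟨c, hc⟩ : ∃ c, l = σ.length + c :=
    Nat.exists_eq_add_of_le (by nlinarith)
  have hsum : (bernoulli p).real (cylinder σ \ F) ≤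
      ∑ τ ∈ (extensions σ l).toFinset, (bernoulli p).real (cylinder τ \ F) := by
    refine (measureReal_mono ?_ (measure_ne_top _ _)).trans (measureReal_biUnion_finset_le _ _)
    simpa only [Set.iUnion_sdiff] using
      Set.sdiff_subset_sdiff_left (cylinder_subset_biUnion_extensions (by omega))
  have hheavy : ∀ τ ∈ (extensions σ l).toFinset,
      (bernoulli p).real (cylinder τ \ F) ≤ 2⁻¹ ^ (4 * σ.length) := fun τ hτ => by
    rw [List.mem_toFinset, mem_extensions (by omega)] at hτ
    exact (measureReal_mono Set.sdiff_subset).trans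
      (real_cylinder_le_two_inv_pow hN₀ hN₁ (hτ.2.trans hl))
  have hlight : ∀ τ ∈ (extensions σ l).toFinset,
      ¬2 ≤ (bernoulli p).real (cylinder τ \ F) * 2 ^ (2 * l) →
      (bernoulli p).real (cylinder τ \ F) ≤ 2 * 2⁻¹ ^ (2 * l) := fun τ _ hτ => by
    rw [inv_pow, ← div_eq_mul_inv, le_div_iff₀ (by positivity)]
    exact (not_le.1 hτ).le
  have hsize : (extensions σ l).toFinset.card ≤ 2 ^ c := by
    refine (List.toFinset_card_le _).trans_eq ?_
    rw [extensions, List.length_map, length_strings, hc, Nat.add_sub_cancel_left]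
  refine (hF.trans_lt' ?_).false
  calc (bernoulli p).real (cylinder σ \ F) * 2 ^ (2 * σ.length)
      ≤ ((1 : ℕ) * 2⁻¹ ^ (4 * σ.length) + (2 ^ c : ℕ) * (2 * 2⁻¹ ^ (2 * l))) *
          2 ^ (2 * σ.length) := by
        gcongr
        refine hsum.trans <|
          (sum_le_card_filter_mul_add_card_mul hheavy (by positivity) hlight).trans ?_
        gcongr
    _ < 1 := by
        push_cast
        rw [one_mul, hc]
        exact two_inv_pow_add_mul_two_pow_lt_one hσ (by nlinarith)

end Spread

/-- The codes of the `μ_p`-Martin-Löf tests relative to `p`. -/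
def testCodes (p : unitInterval) : Set ℕ :=
  {e | ∀ i, bernoulli p (effectiveOpen e (binaryExpansion p) i) ≤ (2⁻¹ : ℝ≥0∞) ^ i}

theorem forbidden_concat_subset (K : ℕ) (z : Cantor) (h : List Bool) (b : Bool) :
    forbidden K z (h ++ [b]) ⊆ forbidden K z h ∪
      {x | b = true ∧ ∃ e, h.length = 2 * e ∧
        x ∈ effectiveOpen e z (stageExponent K (h.length + 1))} := by
  rintro x ⟨e, hb, hx⟩
  rcases lt_trichotomy (2 * e) h.length with hlt | heq | hgt
  · rw [List.getD_append _ _ _ _ hlt] at hb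
    exact Or.inl ⟨e, hb, hx⟩
  · rw [List.getD_append_right _ _ _ _ heq.ge, heq, Nat.sub_self, List.getD_cons_zero] at hb
    exact Or.inr ⟨hb, e, heq.symm, heq ▸ hx⟩
  · rw [List.getD_eq_default _ _ (by simp; omega)] at hb
    exact absurd hb Bool.false_ne_true

section Position

variable {p : unitInterval} {K : ℕ} {h : List Bool}

theorem real_diff_forbidden_le {b : Bool}
    (hb : b = true → ∀ e, h.length = 2 * e → e ∈ testCodes p) (A : Set Cantor) :
    (bernoulli p).real (A \ forbidden K (binaryExpansion p) h) ≤
      (bernoulli p).real (A \ forbidden K (binaryExpansion p) (h ++ [b])) +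
        2⁻¹ ^ stageExponent K (h.length + 1) := by
  set X : Set Cantor := {x | b = true ∧ ∃ e, h.length = 2 * e ∧
    x ∈ effectiveOpen e (binaryExpansion p) (stageExponent K (h.length + 1))}
  have hcover : A \ forbidden K (binaryExpansion p) h ⊆
      (A \ forbidden K (binaryExpansion p) (h ++ [b])) ∪ X := fun x ⟨hA, hx⟩ =>
    (em _).symm.imp (⟨hA, ·⟩) fun hx' => (forbidden_concat_subset K _ h b hx').resolve_left hx
  have hX : (bernoulli p).real X ≤ 2⁻¹ ^ stageExponent K (h.length + 1) := by
    obtain hempty | ⟨-, hbit, e, he, -⟩ := X.eq_empty_or_nonempty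
    · rw [hempty, measureReal_empty]
      positivity
    · have hsub : X ⊆ effectiveOpen e (binaryExpansion p) (stageExponent K (h.length + 1)) := by
        rintro x ⟨-, e', he', hx⟩
        rwa [show e = e' by omega]
      refine (measureReal_mono hsub).trans ?_
      simpa [Measure.real] using
        ENNReal.toReal_mono (by simp) (hb hbit e he (stageExponent K (h.length + 1)))
  calc _ ≤ _ := measureReal_mono hcover
    _ ≤ _ := measureReal_union_le _ _
    _ ≤ _ := by gcongr

/-- The string `σ` is a position that the construction may have reached after the history `h`:
enough of its cylinder is not forbidden. -/
def Position (p : unitInterval) (K : ℕ) (h σ : List Bool) : Prop :=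
  σ.length = K ^ (h.length + 1) ∧
    1 ≤ (bernoulli p).real (cylinder σ \ forbidden K (binaryExpansion p) h) *
      2 ^ stageExponent K h.length

theorem exists_position_nil (p : unitInterval) (K : ℕ) : ∃ σ, Position p K [] σ := by
  have hlikely : ∃ b, (2⁻¹ : ℝ) ^ K ≤ (bernoulli p).real (cylinder (List.replicate K b)) := by
    simp only [bernoulli_real_cylinder]
    rcases le_total (2⁻¹ : ℝ) p with hp | hp
    · exact ⟨false, by simpa [List.count_replicate] using pow_le_pow_left₀ (by norm_num) hp K⟩
    · have hp' : (2⁻¹ : ℝ) ≤ 1 - p := by linarith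
      exact ⟨true, by simpa [List.count_replicate] using pow_le_pow_left₀ (by norm_num) hp' K⟩
  obtain ⟨b, hb⟩ := hlikely
  have hnil : forbidden K (binaryExpansion p) [] = ∅ := by
    ext x
    simp [forbidden]
  refine ⟨List.replicate K b, by simp, ?_⟩
  rw [hnil, Set.sdiff_empty]
  calc (1 : ℝ) = 2⁻¹ ^ K * 2 ^ K := by rw [← mul_pow, inv_mul_cancel₀ two_ne_zero, one_pow]
    _ ≤ _ := by
      gcongr
      · exact one_le_two
      · simp only [stageExponent, List.length_nil, zero_add, pow_one]
        omega

/-- The string `ρ` comes after `τ` (for `b = true`) or before `τ` (for `b = false`) in the order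
of the codes of strings. -/
def Beyond (b : Bool) (τ ρ : List Bool) : Prop :=
  cond b (encode τ < encode ρ) (encode ρ < encode τ)

theorem primrecPred_beyond {α : Type*} [Primcodable α] {b : α → Bool} {τ ρ : α → List Bool}
    (hb : Primrec b) (hτ : Primrec τ) (hρ : Primrec ρ) :
    PrimrecPred fun a => Beyond (b a) (τ a) (ρ a) := by
  have hbit : PrimrecPred fun a => b a = true := Primrec.eq.comp hb (Primrec.const true)
  have hτρ : PrimrecPred fun a => encode (τ a) < encode (ρ a) :=
    Primrec.nat_lt.comp (Primrec.encode.comp hτ) (Primrec.encode.comp hρ)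
  have hρτ : PrimrecPred fun a => encode (ρ a) < encode (τ a) :=
    Primrec.nat_lt.comp (Primrec.encode.comp hρ) (Primrec.encode.comp hτ)
  refine ((hbit.and hτρ).or (hbit.not.and hρτ)).of_eq fun a => ?_
  cases h : b a <;> simp [Beyond]

theorem exists_extremal {G : Finset (List Bool)} (hG : 1 < G.card) (b : Bool) :
    ∃ τ ∈ G, (∀ ρ ∈ G, ¬Beyond b τ ρ) ∧ ∃ ρ ∈ G, Beyond (!b) τ ρ := by
  have hne : G.Nonempty := Finset.card_pos.1 (by omega)
  cases b with
  | false =>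
    obtain ⟨τ, hτ, hmin⟩ := G.exists_min_image encode hne
    obtain ⟨ρ, hρ, hρτ⟩ := Finset.exists_mem_ne hG τ
    exact ⟨τ, hτ, fun ρ hρ => (hmin ρ hρ).not_gt,
      ρ, hρ, (hmin ρ hρ).lt_of_ne (encode_injective.ne hρτ.symm)⟩
  | true =>
    obtain ⟨τ, hτ, hmax⟩ := G.exists_max_image encode hne
    obtain ⟨ρ, hρ, hρτ⟩ := Finset.exists_mem_ne hG τ
    exact ⟨τ, hτ, fun ρ hρ => (hmax ρ hρ).not_gt,
      ρ, hρ, (hmax ρ hρ).lt_of_ne (encode_injective.ne hρτ)⟩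

/-- The finite part `π` of the oracle shows that the position `τ`, reached at the stage after the
history `h`, codes the bit `b`: its competitors beyond it in the direction `b` are all dead. -/
def Decodes (K : ℕ) (π h τ : List Bool) (b : Bool) : Prop :=
  ∀ ρ ∈ extensions (τ.take (K ^ (h.length + 1))) (K ^ (h.length + 2)),
    Beyond b τ ρ → Dead K π h ρ

theorem Decodes.mono {π π' τ : List Bool} {b : Bool} (hd : Decodes K π h τ b)
    (hπ : π <+: π') : Decodes K π' h τ b :=
  fun ρ hρ hb => (hd ρ hρ hb).mono hπ

theorem primrecPred_decodes {α : Type*} [Primcodable α] (K : ℕ) {π h τ : α → List Bool}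
    {b : α → Bool} (hπ : Primrec π) (hh : Primrec h) (hτ : Primrec τ) (hb : Primrec b) :
    PrimrecPred fun a => Decodes K (π a) (h a) (τ a) (b a) := by
  have hpow (c : ℕ) : Primrec fun a => K ^ ((h a).length + c) :=
    primrec_pow.comp (Primrec.const K)
      (Primrec.nat_add.comp (Primrec.list_length.comp hh) (Primrec.const c))
  refine primrecPred_forall_mem
    (primrec_extensions.comp (Primrec.list_take.comp (hpow 1) hτ) (hpow 2)) ?_
  have hbeyond : PrimrecPred fun c : α × List Bool => Beyond (b c.1) (τ c.1) c.2 :=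
    primrecPred_beyond (hb.comp Primrec.fst) (hτ.comp Primrec.fst) Primrec.snd
  have hdead : PrimrecPred fun c : α × List Bool => Dead K (π c.1) (h c.1) c.2 :=
    primrecPred_dead K (hπ.comp Primrec.fst) (hh.comp Primrec.fst) Primrec.snd
  exact (hbeyond.not.or hdead).of_eq fun c => imp_iff_not_or.symm

/-- The position `τ` may follow the position `σ`, reached after the history `h`, in order to code
the bit `b`. -/
structure NextPosition (p : unitInterval) (K : ℕ) (h σ : List Bool) (b : Bool)
    (τ : List Bool) : Prop where
  isPrefix : σ <+: τ
  position : Position p K (h ++ [b]) τ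
  decodes : ∃ k, Decodes K (initSeg (binaryExpansion p) k) h τ b
  not_decodes : ∀ k, ¬Decodes K (initSeg (binaryExpansion p) k) h τ (!b)

theorem position_concat {τ : List Bool} {b : Bool}
    (hb : b = true → ∀ e, h.length = 2 * e → e ∈ testCodes p)
    (hτ : τ.length = K ^ (h.length + 2))
    (h2 : 2 ≤ (bernoulli p).real (cylinder τ \ forbidden K (binaryExpansion p) h) *
      2 ^ stageExponent K (h.length + 1)) : Position p K (h ++ [b]) τ := by
  rw [Position, List.length_append, List.length_singleton]
  refine ⟨hτ, ?_⟩
  have hcancel :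
      (2⁻¹ : ℝ) ^ stageExponent K (h.length + 1) * 2 ^ stageExponent K (h.length + 1) = 1 := by
    rw [← mul_pow, inv_mul_cancel₀ two_ne_zero, one_pow]
  have hloss := mul_le_mul_of_nonneg_right (real_diff_forbidden_le (K := K) hb (cylinder τ))
    (by positivity : (0 : ℝ) ≤ 2 ^ stageExponent K (h.length + 1))
  rw [add_mul, hcancel] at hloss
  linarith

theorem exists_decodes_of_forall_exists_dead {τ : List Bool} {b : Bool} {z : Cantor}
    (hd : ∀ ρ ∈ extensions (τ.take (K ^ (h.length + 1))) (K ^ (h.length + 2)),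
      Beyond b τ ρ → ∃ k, Dead K (initSeg z k) h ρ) :
    ∃ k, Decodes K (initSeg z k) h τ b := by
  have hev : ∀ ρ ∈ (extensions (τ.take (K ^ (h.length + 1))) (K ^ (h.length + 2))).toFinset,
      ∀ᶠ k in atTop, Beyond b τ ρ → Dead K (initSeg z k) h ρ := fun ρ hρ => by
    by_cases hb : Beyond b τ ρ
    · obtain ⟨k, hk⟩ := hd ρ (List.mem_toFinset.1 hρ) hb
      filter_upwards [eventually_ge_atTop k] with j hj _ using hk.mono (initSeg_prefix z hj)
    · exact .of_forall fun k hb' => absurd hb' hb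
  obtain ⟨k, hk⟩ := ((Filter.eventually_all_finset _).2 hev).exists
  exact ⟨k, fun ρ hρ => hk ρ (List.mem_toFinset.2 hρ)⟩

theorem Position.exists_nextPosition (hp : p < 1) {N : ℕ} (hN₀ : 1 ≤ N * (p : ℝ))
    (hN₁ : 1 ≤ N * (1 - (p : ℝ))) {σ : List Bool} (hσ : Position p (4 * N) h σ) {b : Bool}
    (hb : b = true → ∀ e, h.length = 2 * e → e ∈ testCodes p) :
    ∃ τ, NextPosition p (4 * N) h σ b τ := by
  classical
  obtain ⟨hlen, hmeasure⟩ := hσ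
  have hN : 1 ≤ N := one_le_of_one_le_natCast_mul hN₀
  have hlong : σ.length ≤ (4 * N) ^ (h.length + 2) :=
    hlen.trans_le (Nat.pow_le_pow_right (by omega) (by omega))
  have hcard := one_lt_card_filter_extensions hN₀ hN₁ (l := (4 * N) ^ (h.length + 2))
    (hlen ▸ Nat.one_le_pow _ _ (by omega)) (by rw [hlen]; ring)
    (by rwa [stageExponent, ← hlen] at hmeasure)
  obtain ⟨τ, hτ, hextreme, ρ, hρ, hbeyond⟩ := exists_extremal hcard b
  have hdead_iff {ρ : List Bool} : (∃ k, Dead (4 * N) (initSeg (binaryExpansion p) k) h ρ) ↔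
      ¬2 ≤ (bernoulli p).real (cylinder ρ \ forbidden (4 * N) (binaryExpansion p) h) *
        2 ^ (2 * (4 * N) ^ (h.length + 2)) :=
    (exists_dead_initSeg_iff hp).trans not_le.symm
  rw [Finset.mem_filter, List.mem_toFinset] at hτ hρ
  have hτσ := (mem_extensions hlong).1 hτ.1
  have htake : τ.take ((4 * N) ^ (h.length + 1)) = σ := by
    rw [← hlen]
    exact (List.prefix_iff_eq_take.1 hτσ.1).symm
  refine ⟨τ, hτσ.1, position_concat hb hτσ.2 hτ.2,
    exists_decodes_of_forall_exists_dead fun ρ hρ hbeyond => ?_, fun k hd => ?_⟩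
  · rw [htake] at hρ
    exact hdead_iff.2 fun hheavy =>
      hextreme ρ (Finset.mem_filter.2 ⟨List.mem_toFinset.2 hρ, hheavy⟩) hbeyond
  · exact hdead_iff.1 ⟨k, hd ρ (htake.symm ▸ hρ.1) hbeyond⟩ hρ.2

end Position

/-! ### Frequencies compute the parameter -/

section Frequency

open ProbabilityTheory

/-- The indicator function of the event that the bit at position `i` is `0`. -/
def zeroIndicator (i : ℕ) (x : Cantor) : ℝ := if x i = false then 1 else 0

theorem measurable_zeroIndicator (i : ℕ) : Measurable (zeroIndicator i) :=
  (Measurable.of_discrete (f := fun b : Bool => if b = false then (1 : ℝ) else 0)).comp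
    (measurable_pi_apply i)

theorem zeroIndicator_mem_Icc (i : ℕ) (x : Cantor) : zeroIndicator i x ∈ Set.Icc (0 : ℝ) 1 := by
  unfold zeroIndicator
  split_ifs <;> simp

theorem memLp_zeroIndicator (p : unitInterval) (i : ℕ) :
    MemLp (zeroIndicator i) 2 (bernoulli p) := by
  refine MemLp.of_bound (measurable_zeroIndicator i).aestronglyMeasurable 1 (.of_forall fun x => ?_)
  rw [Real.norm_of_nonneg (zeroIndicator_mem_Icc i x).1]
  exact (zeroIndicator_mem_Icc i x).2

theorem iIndepFun_zeroIndicator (p : unitInterval) : iIndepFun zeroIndicator (bernoulli p) :=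
  iIndepFun_infinitePi (X := fun _ (b : Bool) => if b = false then (1 : ℝ) else 0)
    fun _ => Measurable.of_discrete

theorem integral_zeroIndicator (p : unitInterval) (i : ℕ) :
    ∫ x, zeroIndicator i x ∂bernoulli p = p := by
  have heval := measurePreserving_eval_infinitePi
    (fun _ : ℕ => bernoulliMeasure false true p) i
  have hmap := integral_map (μ := bernoulli p) heval.measurable.aemeasurable
    (f := Set.indicator {false} fun _ : Bool => (1 : ℝ)) Measurable.of_discrete.aestronglyMeasurable
  rw [bernoulli, heval.map_eq, integral_indicator_const _ MeasurableSet.of_discrete,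
    bernoulliMeasure_real_apply_of_mem_of_notMem p .of_discrete (Set.mem_singleton _)
      (by simp)] at hmap
  simpa [zeroIndicator, Set.indicator_apply, bernoulli] using hmap.symm

theorem sum_zeroIndicator (x : Cantor) (n : ℕ) :
    ∑ i ∈ Finset.range n, zeroIndicator i x = ((initSeg x n).count false : ℝ) := by
  induction n with
  | zero => simp [initSeg]
  | succ n ih =>
    rw [Finset.sum_range_succ, ih, initSeg_succ, List.count_append]
    cases h : x n <;> simp [zeroIndicator, h]

theorem integral_count_initSeg (p : unitInterval) (n : ℕ) :
    ∫ x, ((initSeg x n).count false : ℝ) ∂bernoulli p = p * n := by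
  simp only [← sum_zeroIndicator]
  rw [integral_finsetSum _ fun i _ => (memLp_zeroIndicator p i).integrable one_le_two]
  simp [integral_zeroIndicator, mul_comm]

theorem variance_sum_zeroIndicator_le (p : unitInterval) (n : ℕ) :
    variance (∑ i ∈ Finset.range n, zeroIndicator i) (bernoulli p) ≤ n := by
  have hvar (i : ℕ) : variance (zeroIndicator i) (bernoulli p) ≤ 1 :=
    (variance_le_sq_of_bounded (.of_forall (zeroIndicator_mem_Icc i))
      (measurable_zeroIndicator i).aemeasurable).trans (by norm_num)
  rw [IndepFun.variance_sum (fun i _ => memLp_zeroIndicator p i)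
    fun i _ k _ hik => (iIndepFun_zeroIndicator p).indepFun hik]
  exact (Finset.sum_le_card_nsmul _ _ 1 fun i _ => hvar i).trans (by simp)

theorem measure_le_abs_count_sub_le (p : unitInterval) (n : ℕ) {c : ℝ} (hc : 0 < c) :
    bernoulli p {x | c ≤ |((initSeg x n).count false : ℝ) - p * n|} ≤
      ENNReal.ofReal (n / c ^ 2) := by
  have h := meas_ge_le_variance_div_sq
    (memLp_finsetSum' (Finset.range n) fun i _ => memLp_zeroIndicator p i) hc
  simp only [Finset.sum_apply, sum_zeroIndicator, integral_count_initSeg] at h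
  refine h.trans (ENNReal.ofReal_le_ofReal ?_)
  gcongr
  exact variance_sum_zeroIndicator_le p n

theorem measure_pow_le_abs_count_sub_le (p : unitInterval) (j : ℕ) :
    bernoulli p {x | (8 : ℝ) ^ j ≤ |((initSeg x (16 ^ j)).count false : ℝ) - p * 16 ^ j|} ≤
      (2⁻¹ : ℝ≥0∞) ^ j := by
  have hbound : ((16 ^ j : ℕ) : ℝ) / ((8 : ℝ) ^ j) ^ 2 ≤ 2⁻¹ ^ j := by
    rw [← pow_mul, mul_comm j, pow_mul, Nat.cast_pow, ← div_pow]
    gcongr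
    norm_num
  have h := (measure_le_abs_count_sub_le p (16 ^ j) (c := 8 ^ j) (by positivity)).trans
    (ENNReal.ofReal_le_ofReal hbound)
  rw [ENNReal.ofReal_pow (by norm_num), ENNReal.ofReal_inv_of_pos (by norm_num)] at h
  simpa using h

end Frequency

/-- The string `ρ` has length `16 ^ j` for some `j > i`, and the first `4 * j` bits of the finite
part `π` of the expansion of `p` show that the number of zeros of `ρ` is far from `p * 16 ^ j`. -/
def Deviates (π : List Bool) (i : ℕ) (ρ : List Bool) : Prop :=
  ∃ j < ρ.length, i < j ∧ 4 * j ≤ π.length ∧ ρ.length = 16 ^ j ∧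
    (ρ.count false + 2 * 8 ^ j < binaryValue (π.take (4 * j)) ∨
      binaryValue (π.take (4 * j)) + 2 * 8 ^ j < ρ.count false)

theorem primrecPred_deviates :
    PrimrecPred fun a : List Bool × ℕ × List Bool => Deviates a.1 a.2.1 a.2.2 := by
  have hρ : Primrec fun b : (List Bool × ℕ × List Bool) × ℕ => b.1.2.2 :=
    Primrec.snd.comp (Primrec.snd.comp Primrec.fst)
  have hπ : Primrec fun b : (List Bool × ℕ × List Bool) × ℕ => b.1.1 :=
    Primrec.fst.comp Primrec.fst
  have h4 : Primrec fun b : (List Bool × ℕ × List Bool) × ℕ => 4 * b.2 :=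
    Primrec.nat_mul.comp (Primrec.const 4) Primrec.snd
  have h8 : Primrec fun b : (List Bool × ℕ × List Bool) × ℕ => 2 * 8 ^ b.2 :=
    Primrec.nat_mul.comp (Primrec.const 2) (primrec_pow.comp (Primrec.const 8) Primrec.snd)
  have hvalue := primrec_binaryValue.comp (Primrec.list_take.comp h4 hπ)
  have hcount := (primrec_count false).comp hρ
  refine primrecPred_exists_lt (Primrec.list_length.comp (Primrec.snd.comp Primrec.snd)) <|
    PrimrecPred.and ?_ <| PrimrecPred.and ?_ <| PrimrecPred.and ?_ <| PrimrecPred.or ?_ ?_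
  · exact Primrec.nat_lt.comp (Primrec.fst.comp (Primrec.snd.comp Primrec.fst)) Primrec.snd
  · exact Primrec.nat_le.comp h4 (Primrec.list_length.comp hπ)
  · exact Primrec.eq.comp (Primrec.list_length.comp hρ)
      (primrec_pow.comp (Primrec.const 16) Primrec.snd)
  · exact Primrec.nat_lt.comp (Primrec.nat_add.comp hcount h8) hvalue
  · exact Primrec.nat_lt.comp (Primrec.nat_add.comp hvalue h8) hcount

section Deviates

variable {p : unitInterval}

theorem Deviates.exists_le_abs_count_sub (hp : p < 1) {k i m : ℕ} {x : Cantor}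
    (h : Deviates (initSeg (binaryExpansion p) k) i (initSeg x m)) :
    ∃ j, i < j ∧ (8 : ℝ) ^ j ≤ |((initSeg x (16 ^ j)).count false : ℝ) - p * 16 ^ j| := by
  obtain ⟨j, -, hij, hk, hm, hdev⟩ := h
  rw [length_initSeg] at hk hm
  subst hm
  rw [take_initSeg _ hk] at hdev
  have hlower := binaryValue_initSeg_le hp (4 * j)
  have hupper := lt_binaryValue_initSeg_add_one hp (4 * j)
  rw [pow_mul, show (2 : ℝ) ^ 4 = 16 by norm_num] at hlower hupper
  have hone : (1 : ℝ) ≤ 8 ^ j := one_le_pow₀ (by norm_num)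
  refine ⟨j, hij, ?_⟩
  rify at hdev
  rw [le_abs]
  rcases hdev with hdev | hdev
  · right
    linarith
  · left
    linarith

theorem abs_count_sub_le_of_not_deviates (hp : p < 1) {i j : ℕ} (hij : i < j) {x : Cantor}
    (h : ¬Deviates (initSeg (binaryExpansion p) (4 * j)) i (initSeg x (16 ^ j))) :
    |((initSeg x (16 ^ j)).count false : ℝ) - p * 16 ^ j| ≤ 3 * 8 ^ j := by
  have hnear : ¬_ := fun hdev => h ⟨j, by simpa using Nat.lt_pow_self (by norm_num), hij, by simp,
    by simp, hdev⟩
  rw [take_initSeg _ le_rfl] at hnear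
  simp only [not_or, not_lt] at hnear
  rify at hnear
  have hlower := binaryValue_initSeg_le hp (4 * j)
  have hupper := lt_binaryValue_initSeg_add_one hp (4 * j)
  rw [pow_mul, show (2 : ℝ) ^ 4 = 16 by norm_num] at hlower hupper
  have hone : (1 : ℝ) ≤ 8 ^ j := one_le_pow₀ (by norm_num)
  rw [abs_le]
  constructor <;> linarith

theorem isMLTest_deviates (hp : p < 1) :
    IsMLTest (bernoulli p) {oracle (binaryExpansion p)} fun i =>
      {x | ∃ k m, Deviates (initSeg (binaryExpansion p) k) i (initSeg x m)} := by
  refine ⟨uniformlySigma1In_of_primrecPred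
    (computableIn_iff_oracle.2 (RecursiveIn.oracle _ (Set.mem_singleton _)))
    primrecPred_deviates, fun i => ?_⟩
  have hsub : {x | ∃ k m, Deviates (initSeg (binaryExpansion p) k) i (initSeg x m)} ⊆ ⋃ d : ℕ,
      {x | (8 : ℝ) ^ (i + (d + 1)) ≤
        |((initSeg x (16 ^ (i + (d + 1)))).count false : ℝ) - p * 16 ^ (i + (d + 1))|} := by
    rintro x ⟨k, m, hdev⟩
    obtain ⟨j, hij, hj⟩ := hdev.exists_le_abs_count_sub hp
    obtain ⟨d, rfl⟩ := Nat.exists_eq_add_of_lt hij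
    exact Set.mem_iUnion.2 ⟨d, hj⟩
  calc bernoulli p _ ≤ ∑' d : ℕ, (2⁻¹ : ℝ≥0∞) ^ (i + (d + 1)) :=
        (measure_mono hsub).trans <| (measure_iUnion_le _).trans <|
          ENNReal.tsum_le_tsum fun d => measure_pow_le_abs_count_sub_le p _
    _ = (2⁻¹ : ℝ≥0∞) ^ i := by
        simp only [pow_add _ i]
        rw [ENNReal.tsum_mul_left, ENNReal.tsum_geometric_add_one, ENNReal.one_sub_inv_two,
          inv_inv, ENNReal.inv_mul_cancel two_ne_zero (by simp), mul_one]

theorem BernoulliRandom.exists_abs_count_sub_le (hp : p < 1) {x : Cantor}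
    (hx : BernoulliRandom p x) :
    ∃ i, ∀ j, i < j → |((initSeg x (16 ^ j)).count false : ℝ) - p * 16 ^ j| ≤ 3 * 8 ^ j := by
  obtain ⟨i, hi⟩ := not_forall.1 (Set.mem_iInter.not.1 (hx _ (isMLTest_deviates hp)))
  exact ⟨i, fun j hij => abs_count_sub_le_of_not_deviates hp hij fun hdev => hi ⟨_, _, hdev⟩⟩

end Deviates

theorem eq_of_binaryValue_eq {π π' : List Bool} (hl : π.length = π'.length)
    (h : binaryValue π = binaryValue π') : π = π' := by
  induction π using List.reverseRecOn generalizing π' with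
  | nil => exact (List.eq_nil_of_length_eq_zero hl.symm).symm
  | append_singleton π b ih =>
    obtain rfl | ⟨π', b', rfl⟩ := List.eq_nil_or_concat' π'
    · simp at hl
    · rw [binaryValue_concat, binaryValue_concat] at h
      obtain ⟨hvalue, rfl⟩ : binaryValue π = binaryValue π' ∧ b = b' := by
        cases b <;> cases b' <;> simp at h ⊢ <;> omega
      rw [ih (by simpa using hl) hvalue]

/-- The interval from `(a - r) / d` to `(a + r) / d`, where `w = (a, r, d)`, lies in the half-open
dyadic interval of the reals whose binary expansion starts with `π`. -/
def Isolates (w : ℕ × ℕ × ℕ) (π : List Bool) : Prop :=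
  binaryValue π * w.2.2 + w.2.1 * 2 ^ π.length ≤ w.1 * 2 ^ π.length ∧
    (w.1 + w.2.1) * 2 ^ π.length < (binaryValue π + 1) * w.2.2

theorem primrecRel_isolates : PrimrecRel Isolates := by
  have ha : Primrec fun b : (ℕ × ℕ × ℕ) × List Bool => b.1.1 := Primrec.fst.comp Primrec.fst
  have hr : Primrec fun b : (ℕ × ℕ × ℕ) × List Bool => b.1.2.1 :=
    Primrec.fst.comp (Primrec.snd.comp Primrec.fst)
  have hd : Primrec fun b : (ℕ × ℕ × ℕ) × List Bool => b.1.2.2 :=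
    Primrec.snd.comp (Primrec.snd.comp Primrec.fst)
  have hvalue : Primrec fun b : (ℕ × ℕ × ℕ) × List Bool => binaryValue b.2 :=
    primrec_binaryValue.comp Primrec.snd
  have hpow : Primrec fun b : (ℕ × ℕ × ℕ) × List Bool => 2 ^ b.2.length :=
    primrec_pow.comp (Primrec.const 2) (Primrec.list_length.comp Primrec.snd)
  exact (Primrec.nat_le.comp (Primrec.nat_add.comp (Primrec.nat_mul.comp hvalue hd)
    (Primrec.nat_mul.comp hr hpow)) (Primrec.nat_mul.comp ha hpow)).and
    (Primrec.nat_lt.comp (Primrec.nat_mul.comp (Primrec.nat_add.comp ha hr) hpow)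
      (Primrec.nat_mul.comp (Primrec.succ.comp hvalue) hd))

section Approximation

variable {p : unitInterval}

theorem Isolates.mem_cylinder (hp : p < 1) {a r d : ℕ} {π : List Bool}
    (h : Isolates (a, r, d) π) (hd : 0 < d) (happrox : |(a : ℝ) - p * d| ≤ r) :
    binaryExpansion p ∈ cylinder π := by
  obtain ⟨hlower, hupper⟩ := h
  obtain ⟨hleft, hright⟩ := abs_le.1 happrox
  rify at hlower hupper hd
  have hpow : (0 : ℝ) < 2 ^ π.length := by positivity
  have hle : (binaryValue π : ℝ) ≤ p * 2 ^ π.length := by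
    refine le_of_mul_le_mul_right ?_ hd
    have := mul_le_mul_of_nonneg_right hright hpow.le
    linarith
  have hlt : (p : ℝ) * 2 ^ π.length < binaryValue π + 1 := by
    refine lt_of_mul_lt_mul_right ?_ hd.le
    have := mul_le_mul_of_nonneg_right hleft hpow.le
    linarith
  rw [mem_cylinder_iff]
  refine eq_of_binaryValue_eq (length_initSeg _ _) ?_
  rw [binaryValue_initSeg hp, Nat.floor_eq_iff (hle.trans' (by positivity))]
  exact ⟨hle, hlt⟩

theorem isolates_initSeg {a r d t : ℕ} (hd : 0 < d) (happrox : |(a : ℝ) - p * d| ≤ r)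
    (hlower : binaryValue (initSeg (binaryExpansion p) t) + 2 * 2 ^ t * (r / d : ℝ) ≤ p * 2 ^ t)
    (hupper : p * 2 ^ t + 2 * 2 ^ t * (r / d : ℝ) <
      binaryValue (initSeg (binaryExpansion p) t) + 1) :
    Isolates (a, r, d) (initSeg (binaryExpansion p) t) := by
  obtain ⟨hleft, hright⟩ := abs_le.1 happrox
  have hd' : (0 : ℝ) < d := Nat.cast_pos.2 hd
  have hpow : (0 : ℝ) < 2 ^ t := by positivity
  have hleft' := mul_le_mul_of_nonneg_right hleft hpow.le
  have hright' := mul_le_mul_of_nonneg_right hright hpow.le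
  have hlower' := mul_le_mul_of_nonneg_right hlower hd'.le
  have hupper' := mul_lt_mul_of_pos_right hupper hd'
  rw [add_mul, mul_assoc _ (r / d : ℝ), div_mul_cancel₀ _ hd'.ne'] at hlower' hupper'
  simp only [Isolates, length_initSeg]
  rify
  constructor <;> linarith

/-- Inside the half-open dyadic intervals good enough approximations isolate the expansion of `p`;
if `p` is the end point of such an interval, then `p` itself is used. -/
theorem computableIn_binaryExpansion_of_approx {O : Set (ℕ →. ℕ)} (hp : p < 1) {a r d : ℕ → ℕ}
    (hcomp : ComputableIn O fun j => (a j, r j, d j)) (hd : ∀ j, 0 < d j)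
    (happrox : ∀ j, |(a j : ℝ) - p * d j| ≤ r j)
    (hlim : Tendsto (fun j => (r j : ℝ) / d j) atTop (𝓝 0)) :
    ComputableIn O (binaryExpansion p) := by
  by_cases hdyadic : ∃ s b : ℕ, (p : ℝ) * 2 ^ s = b
  · obtain ⟨s, b, hb⟩ := hdyadic
    have hexact : |(b : ℝ) - p * (2 ^ s : ℕ)| ≤ (0 : ℕ) := by simp [← hb]
    refine computableIn_of_certificate (β := ℕ × ℕ × ℕ) (g := fun _ => (b, 0, 2 ^ s))
      (Primrec.const _).computableIn primrecRel_isolates (fun t => ⟨0, ?_⟩)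
      fun _ π h => h.mem_cylinder hp (by positivity) hexact
    exact isolates_initSeg (by positivity) hexact (by simpa using binaryValue_initSeg_le hp t)
      (by simpa using lt_binaryValue_initSeg_add_one hp t)
  · push Not at hdyadic
    refine computableIn_of_certificate hcomp primrecRel_isolates (fun t => ?_)
      fun j π h => h.mem_cylinder hp (hd j) (happrox j)
    have hlower := (binaryValue_initSeg_le hp t).lt_of_ne fun h => hdyadic t _ h.symm
    have hlim' : Tendsto (fun j => 2 * 2 ^ t * ((r j : ℝ) / d j)) atTop (𝓝 0) := by
      simpa using hlim.const_mul (2 * 2 ^ t)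
    obtain ⟨j, hj, hj'⟩ := ((hlim'.eventually_lt_const (sub_pos.2 hlower)).and
      (hlim'.eventually_lt_const (sub_pos.2 (lt_binaryValue_initSeg_add_one hp t)))).exists
    exact ⟨j, isolates_initSeg (hd j) (happrox j) (by linarith) (by linarith)⟩

theorem BernoulliRandom.computableIn_binaryExpansion (hp : p < 1) {x : Cantor}
    (hx : BernoulliRandom p x) {O : Set (ℕ →. ℕ)} (hxO : ComputableIn O x) :
    ComputableIn O (binaryExpansion p) := by
  obtain ⟨i, hi⟩ := hx.exists_abs_count_sub_le hp
  have hpow (b : ℕ) : Primrec fun j : ℕ => b ^ (i + 1 + j) :=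
    primrec_pow.comp (Primrec.const b) (Primrec.nat_add.comp (Primrec.const (i + 1)) Primrec.id)
  have hcount : ComputableIn O fun j => (initSeg x (16 ^ (i + 1 + j))).count false :=
    computableIn_comp (primrec_count false).computableIn
      (computableIn_comp (computableIn_initSeg hxO) (hpow 16).computableIn)
  have herror : Primrec fun j => 3 * 8 ^ (i + 1 + j) :=
    Primrec.nat_mul.comp (Primrec.const 3) (hpow 8)
  refine computableIn_binaryExpansion_of_approx hp
    (computableIn_pair hcount (herror.pair (hpow 16)).computableIn) (fun j => by positivity)
    (fun j => by simpa using hi (i + 1 + j) (by omega)) ?_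
  have hratio (j : ℕ) : ((3 * 8 ^ (i + 1 + j) : ℕ) : ℝ) / (16 ^ (i + 1 + j) : ℕ) =
      3 * 2⁻¹ ^ (i + 1) * 2⁻¹ ^ j := by
    push_cast
    rw [mul_div_assoc, ← div_pow, mul_assoc, ← pow_add]
    norm_num
  simp only [hratio]
  simpa only [mul_zero] using (tendsto_pow_atTop_nhds_zero_of_lt_one (r := (2⁻¹ : ℝ)) (by norm_num)
    (by norm_num)).const_mul (3 * 2⁻¹ ^ (i + 1))

end Approximation

/-! ### Sequences that code other sequences -/

/-- The limit of strings `σ n` that extend one another; the length of `σ n` is to exceed `n`. -/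
def limitSeq (σ : ℕ → List Bool) : Cantor := fun i => (σ i).getD i false

/-- The strings `σ n` are initial segments of a sequence that codes `D`, and the bits of `D` at even
positions single out the `μ_p`-Martin-Löf tests. -/
structure CodingPath (p : unitInterval) (K : ℕ) (D : Cantor) (σ : ℕ → List Bool) : Prop where
  two_le : 2 ≤ K
  position_zero : Position p K [] (σ 0)
  next : ∀ n, NextPosition p K (initSeg D n) (σ n) (D n) (σ (n + 1))
  test : ∀ e, D (2 * e) = true ↔ e ∈ testCodes p

/-- Read with the finite part `π` of the oracle, the string `ξ` codes the history `h`, where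
`w = (ξ, π)`. The position reached at stage `i` is the initial segment of `ξ` of length
`K ^ (i + 1)`. -/
def DecodesHistory (K : ℕ) (w : List Bool × List Bool) (h : List Bool) : Prop :=
  K ^ (h.length + 1) ≤ w.1.length ∧
    ∀ i < h.length, Decodes K w.2 (h.take i) (w.1.take (K ^ (i + 2))) (h.getD i false)

theorem primrecRel_decodesHistory (K : ℕ) : PrimrecRel (DecodesHistory K) := by
  have hξ : Primrec fun a : (List Bool × List Bool) × List Bool => a.1.1 :=
    Primrec.fst.comp Primrec.fst
  have hpow (c : ℕ) : Primrec fun n : ℕ => K ^ (n + c) :=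
    primrec_pow.comp (Primrec.const K) (Primrec.nat_add.comp Primrec.id (Primrec.const c))
  have hlen := Primrec.list_length.comp (Primrec.snd (α := List Bool × List Bool) (β := List Bool))
  exact (Primrec.nat_le.comp ((hpow 1).comp hlen) (Primrec.list_length.comp hξ)).and <|
    primrecPred_forall_lt hlen <| primrecPred_decodes K
      (Primrec.snd.comp (Primrec.fst.comp Primrec.fst))
      (Primrec.list_take.comp Primrec.snd (Primrec.snd.comp Primrec.fst))
      (Primrec.list_take.comp ((hpow 2).comp Primrec.snd) (hξ.comp Primrec.fst))
      ((Primrec.list_getD false).comp (Primrec.snd.comp Primrec.fst) Primrec.snd)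

namespace CodingPath

variable {p : unitInterval} {K : ℕ} {D : Cantor} {σ : ℕ → List Bool}

theorem position (hc : CodingPath p K D σ) : ∀ n, Position p K (initSeg D n) (σ n)
  | 0 => hc.position_zero
  | n + 1 => by
    rw [initSeg_succ]
    exact (hc.next n).position

theorem length_eq (hc : CodingPath p K D σ) (n : ℕ) : (σ n).length = K ^ (n + 1) := by
  rw [(hc.position n).1, length_initSeg]

theorem lt_length (hc : CodingPath p K D σ) (n : ℕ) : n < (σ n).length := by
  rw [hc.length_eq]
  exact (Nat.lt_succ_self n).trans (Nat.lt_pow_self hc.two_le)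

theorem prefix_of_le (hc : CodingPath p K D σ) {m n : ℕ} (h : m ≤ n) : σ m <+: σ n := by
  induction n, h using Nat.le_induction with
  | base => exact List.prefix_rfl
  | succ n _ ih => exact ih.trans (hc.next n).isPrefix

theorem getD_eq_limitSeq (hc : CodingPath p K D σ) {i n : ℕ}
    (hi : i < (σ n).length) : (σ n).getD i false = limitSeq σ i := by
  have hagree {m n : ℕ} (hmn : m ≤ n) (hm : i < (σ m).length) :
      (σ n).getD i false = (σ m).getD i false := by
    obtain ⟨r, hr⟩ := hc.prefix_of_le hmn
    rw [← hr, List.getD_append _ _ _ _ hm]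
  rcases le_total i n with h | h
  · exact hagree h (hc.lt_length i)
  · exact (hagree h hi).symm

theorem initSeg_limitSeq (hc : CodingPath p K D σ) (n : ℕ) :
    initSeg (limitSeq σ) (K ^ (n + 1)) = σ n := by
  refine List.ext_getElem (by simp [hc.length_eq]) fun i h₁ h₂ => ?_
  rw [← List.getD_eq_getElem _ false h₂, hc.getD_eq_limitSeq h₂]
  simp [initSeg]

theorem limitSeq_notMem_effectiveOpen (hc : CodingPath p K D σ) {e : ℕ}
    (he : e ∈ testCodes p) :
    limitSeq σ ∉ effectiveOpen e (binaryExpansion p) (stageExponent K (2 * e + 1)) := by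
  rintro ⟨k, j, henum⟩
  set n := max (2 * e + 1) j
  have hj : j ≤ K ^ (n + 1) :=
    (le_max_right _ _).trans (((hc.lt_length n).trans_eq (hc.length_eq n)).le)
  have hsub : cylinder (σ n) ⊆ forbidden K (binaryExpansion p) (initSeg D n) := by
    intro x hx
    refine ⟨e, ?_, k, j, ?_⟩
    · rw [List.getD_eq_getElem?_getD, getElem?_initSeg D (by omega), Option.getD_some]
      exact (hc.test e).2 he
    · rw [mem_cylinder_iff, hc.length_eq, ← hc.initSeg_limitSeq] at hx
      rwa [← take_initSeg x hj, hx, take_initSeg _ hj]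
  have hpos := (hc.position n).2
  rw [Set.sdiff_eq_empty.2 hsub, measureReal_empty, zero_mul] at hpos
  exact absurd hpos (by norm_num)

theorem bernoulliRandom (hc : CodingPath p K D σ) :
    BernoulliRandom p (limitSeq σ) := by
  rintro U ⟨hU, hμ⟩ hx
  obtain ⟨e, he⟩ := hU.exists_code
  simp only [he, Set.mem_iInter] at hμ hx
  exact hc.limitSeq_notMem_effectiveOpen hμ (hx _)

theorem exists_decodesHistory (hc : CodingPath p K D σ) (n : ℕ) :
    ∃ k, DecodesHistory K (initSeg (limitSeq σ) k, initSeg (binaryExpansion p) k)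
      (initSeg D n) := by
  choose f hf using fun i => (hc.next i).decodes
  refine ⟨max (K ^ (n + 1)) ((Finset.range n).sup f), by simp, fun i hi => ?_⟩
  rw [length_initSeg] at hi
  have hpow : K ^ (i + 2) ≤ K ^ (n + 1) :=
    Nat.pow_le_pow_right (zero_lt_two.trans_le hc.two_le) (by omega)
  rw [take_initSeg _ hi.le, take_initSeg _ (hpow.trans (le_max_left _ _)),
    List.getD_eq_getElem?_getD, getElem?_initSeg D hi, Option.getD_some,
    hc.initSeg_limitSeq (i + 1)]
  exact (hf i).mono
    (initSeg_prefix _ ((Finset.le_sup (Finset.mem_range.2 hi)).trans (le_max_right _ _)))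

theorem mem_cylinder_of_decodesHistory (hc : CodingPath p K D σ) {k : ℕ}
    {h : List Bool}
    (hh : DecodesHistory K (initSeg (limitSeq σ) k, initSeg (binaryExpansion p) k) h) :
    D ∈ cylinder h := by
  obtain ⟨hlen, hdec⟩ := hh
  rw [length_initSeg] at hlen
  suffices htake : ∀ i ≤ h.length, initSeg D i = h.take i by
    rw [mem_cylinder_iff, htake _ le_rfl, List.take_length]
  intro i hi
  induction i with
  | zero => simp [initSeg]
  | succ i ih =>
    have hpow : K ^ (i + 2) ≤ k :=
      (Nat.pow_le_pow_right (zero_lt_two.trans_le hc.two_le) (by omega)).trans hlen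
    have hi' := hdec i hi
    rw [← ih (by omega), take_initSeg _ hpow, hc.initSeg_limitSeq (i + 1)] at hi'
    have hbit : D i = h.getD i false := by
      by_contra hne
      rw [Bool.eq_not_of_ne (Ne.symm hne)] at hi'
      exact (hc.next i).not_decodes _ hi'
    rw [initSeg_succ, ih (by omega), hbit, List.take_succ_eq_append_getElem hi,
      List.getD_eq_getElem _ _ hi]

theorem computableIn_history (hc : CodingPath p K D σ) {O : Set (ℕ →. ℕ)}
    (hx : ComputableIn O (limitSeq σ)) (hz : ComputableIn O (binaryExpansion p)) :
    ComputableIn O D :=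
  computableIn_of_certificate
    (computableIn_pair (computableIn_initSeg hx) (computableIn_initSeg hz))
    (primrecRel_decodesHistory K) (hc.exists_decodesHistory)
    fun _ _ => hc.mem_cylinder_of_decodesHistory

theorem recursiveIn_limitSeq (hc : CodingPath p K D σ) (hp : p < 1) {y : Cantor}
    (hy : ∀ m, D (2 * m + 1) = y m) : RecursiveIn {oracle (limitSeq σ)} (oracle y) := by
  have hx : ComputableIn {oracle (limitSeq σ)} (limitSeq σ) :=
    computableIn_iff_oracle.2 (RecursiveIn.oracle _ (Set.mem_singleton _))
  have hD := hc.computableIn_history hx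
    ((hc.bernoulliRandom).computableIn_binaryExpansion hp hx)
  rw [← computableIn_iff_oracle, ← funext hy]
  exact computableIn_comp hD Primrec.nat_double_succ.computableIn

end CodingPath

theorem exists_nat_one_le_mul {p : unitInterval} (hp₀ : 0 < p) (hp₁ : p < 1) :
    ∃ N : ℕ, 1 ≤ N * (p : ℝ) ∧ 1 ≤ N * (1 - (p : ℝ)) := by
  have h₀ : (0 : ℝ) < p := hp₀
  have h₁ : (0 : ℝ) < 1 - p := sub_pos.2 hp₁
  obtain ⟨N, hN⟩ := exists_nat_ge (max (p : ℝ)⁻¹ (1 - (p : ℝ))⁻¹)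
  rw [max_le_iff, inv_le_iff_one_le_mul₀ h₀, inv_le_iff_one_le_mul₀ h₁] at hN
  exact ⟨N, hN⟩

theorem exists_codingPath_of_history {p : unitInterval} (hp₀ : 0 < p) (hp₁ : p < 1) :
    ∃ (K : ℕ) (pos : List Bool → List Bool), ∀ D : Cantor,
      (∀ e, D (2 * e) = true ↔ e ∈ testCodes p) → CodingPath p K D fun n => pos (initSeg D n) := by
  obtain ⟨N, hN₀, hN₁⟩ := exists_nat_one_le_mul hp₀ hp₁
  have hN : 1 ≤ N := one_le_of_one_le_natCast_mul hN₀
  have hnext (h σ : List Bool) (b : Bool) : ∃ τ, Position p (4 * N) h σ →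
      (b = true → ∀ e, h.length = 2 * e → e ∈ testCodes p) → NextPosition p (4 * N) h σ b τ := by
    by_cases hσ : Position p (4 * N) h σ ∧
        (b = true → ∀ e, h.length = 2 * e → e ∈ testCodes p)
    · obtain ⟨τ, hτ⟩ := hσ.1.exists_nextPosition hp₁ hN₀ hN₁ hσ.2
      exact ⟨τ, fun _ _ => hτ⟩
    · exact ⟨[], fun h₁ h₂ => absurd ⟨h₁, h₂⟩ hσ⟩
  choose next hnext using hnext
  obtain ⟨σ₀, hσ₀⟩ := exists_position_nil p (4 * N)
  let pos (h : List Bool) : List Bool := List.reverseRecOn h σ₀ fun h b σ => next h σ b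
  have hpos_concat (h : List Bool) (b : Bool) : pos (h ++ [b]) = next h (pos h) b :=
    List.reverseRecOn_concat _ _ _ _
  have hpos_nil : Position p (4 * N) [] (pos []) := by
    rwa [show pos [] = σ₀ from List.reverseRecOn_nil _ _]
  refine ⟨4 * N, pos, fun D hD => ?_⟩
  have hbit (n : ℕ) (hDn : D n = true) (e : ℕ) (he : (initSeg D n).length = 2 * e) :
      e ∈ testCodes p := by
    rw [length_initSeg] at he
    exact (hD e).1 (he ▸ hDn)
  have hposition (n : ℕ) : Position p (4 * N) (initSeg D n) (pos (initSeg D n)) := by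
    induction n with
    | zero => exact hpos_nil
    | succ n ih =>
      rw [initSeg_succ, hpos_concat]
      exact (hnext _ _ _ ih (hbit n)).position
  refine ⟨by omega, hpos_nil, fun n => ?_, hD⟩
  rw [initSeg_succ, hpos_concat]
  exact hnext _ _ _ (hposition n) (hbit n)

theorem exists_eq_apply_initSeg {α : Type*} (F : List α → α) :
    ∃ x : ℕ → α, ∀ n, x n = F (initSeg x n) := by
  let s (n : ℕ) : List α := Nat.rec [] (fun _ l => l ++ [F l]) n
  refine ⟨fun n => F (s n), fun n => congrArg F ?_⟩
  induction n with
  | zero => rfl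
  | succ n ih => rw [initSeg_succ, ← ih]

open Classical in
/-- The bit to be coded after the history `h`: whether a number is the code of a test, or the next
bit of the partner, which has reached the position `τ`. -/
noncomputable def nextBit (p : unitInterval) (h τ : List Bool) : Bool :=
  if h.length % 2 = 0 then decide (h.length / 2 ∈ testCodes p) else τ.getD (h.length / 2) false

theorem nextBit_of_length_eq_two_mul (p : unitInterval) {h : List Bool} (τ : List Bool) {e : ℕ}
    (he : h.length = 2 * e) : nextBit p h τ = true ↔ e ∈ testCodes p := by
  simp [nextBit, he]

theorem nextBit_of_length_eq_two_mul_add_one (p : unitInterval) {h : List Bool} (τ : List Bool)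
    {m : ℕ} (hm : h.length = 2 * m + 1) : nextBit p h τ = τ.getD m false := by
  rw [nextBit, if_neg (by omega), show h.length / 2 = m by omega]

theorem exists_codingPaths {p q : unitInterval} (hp₀ : 0 < p) (hp₁ : p < 1) (hq₀ : 0 < q)
    (hq₁ : q < 1) :
    ∃ (K L : ℕ) (D E : Cantor) (σ τ : ℕ → List Bool), CodingPath p K D σ ∧ CodingPath q L E τ ∧
      (∀ m, D (2 * m + 1) = limitSeq τ m) ∧ ∀ m, E (2 * m + 1) = limitSeq σ m := by
  obtain ⟨K, pos, hpos⟩ := exists_codingPath_of_history hp₀ hp₁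
  obtain ⟨L, pos', hpos'⟩ := exists_codingPath_of_history hq₀ hq₁
  obtain ⟨w, hw⟩ := exists_eq_apply_initSeg fun l : List (Bool × Bool) =>
    (nextBit p (l.map Prod.fst) (pos' (l.map Prod.snd)),
      nextBit q (l.map Prod.snd) (pos (l.map Prod.fst)))
  let D : Cantor := fun n => (w n).1
  let E : Cantor := fun n => (w n).2
  have hfst (n : ℕ) : (initSeg w n).map Prod.fst = initSeg D n := by simp [initSeg, D]
  have hsnd (n : ℕ) : (initSeg w n).map Prod.snd = initSeg E n := by simp [initSeg, E]
  have hD (n : ℕ) : D n = nextBit p (initSeg D n) (pos' (initSeg E n)) := by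
    rw [← hfst, ← hsnd]
    exact congrArg Prod.fst (hw n)
  have hE (n : ℕ) : E n = nextBit q (initSeg E n) (pos (initSeg D n)) := by
    rw [← hfst, ← hsnd]
    exact congrArg Prod.snd (hw n)
  have hcD := hpos D fun e => hD _ ▸ nextBit_of_length_eq_two_mul p _ (length_initSeg D _)
  have hcE := hpos' E fun e => hE _ ▸ nextBit_of_length_eq_two_mul q _ (length_initSeg E _)
  refine ⟨K, L, D, E, _, _, hcD, hcE, fun m => ?_, fun m => ?_⟩
  · rw [hD, nextBit_of_length_eq_two_mul_add_one p _ (length_initSeg D _)]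
    exact hcE.getD_eq_limitSeq ((by omega : m < 2 * m + 1).trans (hcE.lt_length _))
  · rw [hE, nextBit_of_length_eq_two_mul_add_one q _ (length_initSeg E _)]
    exact hcD.getD_eq_limitSeq ((by omega : m < 2 * m + 1).trans (hcD.lt_length _))

theorem PassesMLTests.mono {μ : Measure Cantor} {O O' : Set (ℕ →. ℕ)} {x : Cantor}
    (h : PassesMLTests μ O' x) (hO : O ⊆ O') : PassesMLTests μ O x := by
  rintro U ⟨⟨f, hf, hU⟩, hm⟩
  exact h U ⟨⟨f, RecursiveIn.mono hO hf, hU⟩, hm⟩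

end BernoulliRandomness

open BernoulliRandomness in
theorem mainTheorem7_general (p q : unitInterval) (hp₀ : 0 < p) (hp₁ : p < 1) (hq₀ : 0 < q)
    (hq₁ : q < 1) :
    ∃ x y : Cantor, BernoulliRandom p x ∧ BernoulliRandom q y ∧ TuringEquiv x y := by
  obtain ⟨K, L, D, E, σ, τ, hcD, hcE, hD, hE⟩ := exists_codingPaths hp₀ hp₁ hq₀ hq₁
  exact ⟨limitSeq σ, limitSeq τ, hcD.bernoulliRandom, hcE.bernoulliRandom,
    hcE.recursiveIn_limitSeq hq₁ hE, hcD.recursiveIn_limitSeq hp₁ hD⟩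

theorem mainTheorem7 (p : unitInterval) (hp₀ : 0 < p) (hp₁ : p < 1) :
    ∃ x y : BernoulliRandomness.Cantor, BernoulliRandomness.BernoulliRandom p x ∧
      BernoulliRandomness.MLRandom y ∧ BernoulliRandomness.TuringEquiv x y := by
  obtain ⟨x, y, hx, hy, hxy⟩ := mainTheorem7_general p
    ⟨1 / 2, by norm_num, by norm_num⟩ hp₀ hp₁
    (Subtype.mk_lt_mk.2 (by norm_num)) (Subtype.mk_lt_mk.2 (by norm_num))
  exact ⟨x, y, hx, hy.mono (Set.empty_subset _), hxy⟩
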